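/- Let $(\mathfrak{X},\pi)$ be a measure space with $0<\pi(\mathfrak{X})<\infty$, let $a:\mathfrak{X}\to\mathbb{R}$ be bounded and measurable, and let $s:\mathfrak{X}^2\to[0,\infty)$, $(x,y)\mapsto s_{xy}$, be bounded, measurable and symmetric ($s_{xy}=s_{yx}$). Let $(Sw)_x=\int s_{xy}w_y\,\pi(\mathrm{d}y)$, let $\mathbb{H}=\{z\in\mathbb{C}:\operatorname{Im}z>0\}$ and $\overline{\mathbb{H}}=\mathbb{H}\cup\mathbb{R}$, and consider the quadratic vector equation (QVE) $$-\frac{1}{m_x(z)}=z+a_x+(Sm(z))_x,\qquad x\in\mathfrak{X},\ z\in\mathbb{H},$$ where for each $z\in\mathbb{H}$ the function $m(z):\mathfrak{X}\to\mathbb{H}$ is required to be bounded and measurable. Assume: (A) there is a bounded measurable symmetric function $r:\mathfrak{X}^2\to[0,\infty)$ with $s_{xy}\ge\int r_{xu}r_{uy}\,\pi(\mathrm{d}u)$ for all $x,y$ and $\inf_{x}\int r_{xy}\,\pi(\mathrm{d}y)>0$; (B) there is an integer $K\ge1$ with $\inf_{x,y}s^{(K)}_{xy}>0$, where $s^{(1)}=s$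 and $s^{(k+1)}_{xy}=\int s^{(k)}_{xu}s_{uy}\,\pi(\mathrm{d}u)$ (the integral kernel of $S^{K}$); (C) $\displaystyle\lim_{\varepsilon\downarrow0}\inf_{x\in\mathfrak{X}}\int\frac{\pi(\mathrm{d}y)}{\varepsilon+(a_x-a_y)^2+\int(s_{xu}-s_{yu})^2\,\pi(\mathrm{d}u)}=\infty.$ Then the QVE has a unique solution $m$, and there is a unique bounded measurable function $\mathfrak{X}\times\overline{\mathbb{H}}\to\overline{\mathbb{H}}$, again written $(x,z)\mapsto m_x(z)$, which extends $m$ and is uniformly $1/3$-Hölder continuous in $z$, uniformly in $x$: $$\sup_{x\in\mathfrak{X}}\ \sup_{z_1\ne z_2\in\overline{\mathbb{H}}}\frac{|m_x(z_1)-m_x(z_2)|}{|z_1-z_2|^{1/3}}<\infty.$$ -/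

import Mathlib

open MeasureTheory Filter Topology
open scoped NNReal UpperHalfPlane

namespace QVE

/-- Membership in the space `𝓑(𝔄, 𝔻)` of bounded measurable functions on the measurable
space `A` with values in the set `D`. -/
structure IsBoundedMeasurable {A E : Type*} [MeasurableSpace A] [NormedAddCommGroup E]
    [MeasurableSpace E] (D : Set E) (f : A → E) : Prop where
  measurable : Measurable f
  mem : ∀ t, f t ∈ D
  bounded : ∃ C : ℝ, ∀ t, ‖f t‖ ≤ C

/-- The closed upper half-plane, as a type. -/
abbrev ClosedUpperHalfPlane : Type := {z : ℂ // 0 ≤ z.im}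

/-- The inclusion of the open upper half-plane into the closed one. -/
def toClosed (z : ℍ) : ClosedUpperHalfPlane := ⟨(z : ℂ), z.im_pos.le⟩

section

variable {X : Type*} [MeasurableSpace X]

/-- The integral operator `S` with kernel `s`: `(S w)_x = ∫ s_{xy} w_y π(dy)`. -/
noncomputable def intOp (π : Measure X) (s : X → X → ℝ) (w : X → ℂ) (x : X) : ℂ :=
  ∫ y, (s x y : ℂ) * w y ∂π

/-- A non-negative, symmetric, bounded and (jointly) measurable kernel on `X × X`. -/
structure IsKernel (s : X → X → ℝ) : Prop where
  bddMeas : IsBoundedMeasurable (Set.Ici 0) (fun p : X × X => s p.1 p.2)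
  symm : ∀ x y, s x y = s y x

/-- `m : ℍ → 𝓑(X, ℍ)` solves the quadratic vector equation `-1 / m(z) = z + a + S m(z)`. -/
structure IsSolution (π : Measure X) (a : X → ℝ) (s : X → X → ℝ) (m : ℍ → X → ℂ) : Prop where
  bddMeas : ∀ z, IsBoundedMeasurable {w : ℂ | 0 < w.im} (m z)
  eqn : ∀ z x, -(1 / m z x) = (z : ℂ) + (a x : ℂ) + intOp π s (m z) x

/-- Diagonal positivity. -/
def DiagonalPositivity (π : Measure X) (s : X → X → ℝ) : Prop :=
  ∃ r : X → X → ℝ, IsKernel r ∧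
    (∀ x y, ∫ u, r x u * r u y ∂π ≤ s x y) ∧
    ∃ c : ℝ, 0 < c ∧ ∀ x, c ≤ ∫ y, r x y ∂π

/-- `iterKernel π s n` is the integral kernel of the operator power `S ^ (n + 1)`. -/
noncomputable def iterKernel (π : Measure X) (s : X → X → ℝ) : ℕ → X → X → ℝ
  | 0 => s
  | n + 1 => fun x y => ∫ u, iterKernel π s n x u * s u y ∂π

/-- Uniform primitivity: for some `K = n + 1 ≥ 1` the kernel of `S ^ K` is bounded below by a
positive constant. -/
def UniformPrimitivity (π : Measure X) (s : X → X → ℝ) : Prop :=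
  ∃ n : ℕ, ∃ c : ℝ, 0 < c ∧ ∀ x y, c ≤ iterKernel π s n x y

/-- Component regularity (no outlier components). -/
def ComponentRegularity (π : Measure X) (a : X → ℝ) (s : X → X → ℝ) : Prop :=
  Tendsto
    (fun ε : ℝ => ⨅ x : X, ∫ y, 1 / (ε + (a x - a y) ^ 2 + ∫ u, (s x u - s y u) ^ 2 ∂π) ∂π)
    (𝓝[>] 0) atTop

/-- `M` is a bounded measurable function on `X × ℍ̄` with values in the closed upper half-plane
`ℍ̄` that extends `m` and is `1/3`-Hölder continuous in its second argument, uniformly in the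
first one. -/
structure IsHolderExtension (m : ℍ → X → ℂ) (M : X → ClosedUpperHalfPlane → ℂ) : Prop where
  bddMeas : IsBoundedMeasurable {w : ℂ | 0 ≤ w.im}
    (fun p : X × ClosedUpperHalfPlane => M p.1 p.2)
  extends_eq : ∀ x z, M x (toClosed z) = m z x
  holder : ∃ C : ℝ≥0, ∀ x, HolderWith C (1 / 3) (M x)

end

end QVE

/-!
# Existence and Hölder regularity of the solution of the quadratic vector equation

The proof compares two solutions algebraically and needs neither derivatives in the spectral
parameter nor spectral theory. Write `m₁, m₂` for solutions at `z₁, z₂`, and `w = m₁ - m₂`. Then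
`w = m₁ m₂ (z₁ - z₂ + S w)`, while the imaginary part of the equation and the Cauchy–Schwarz
inequality show that the geometric mean `t = (Im m₁ Im m₂)^{1/2}` is a supersolution:
`|m₁ m₂| ((Im z₁ Im z₂)^{1/2} + S t) ≤ t` (`IsStep.le_sqrt_im`). This inequality
is used in two ways.

* The fixed point map contracts differences measured relative to `t` (`IsStep.contraction`). This
  gives existence and uniqueness, and also the Schwarz–Pick inequality
  `|w| ≤ |z₁ - z₂| (Im z₁ Im z₂)^{-1/2} t` (`norm_sub_le_of_isStep`).
* By the Schur test, the quadratic form of `S` is bounded by multiplication by `1 / |m₁ m₂|`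
  (`IsStep.integral_kernel_le`). With `m₁ = m₂` and diagonal positivity this bounds `m` in `L²`, and
  component regularity turns that into a uniform bound (`exists_norm_solution_le`).

For stability, let `e = m₁ m₂ / |m₁ m₂|`. Testing the equation for `w` against `w̄ / |m₁ m₂|` and
using the Schur bound shows that the defects `|w_x| |w_y| - Re (e_x w̄_x w_y)` integrate against
`s` to at most `|z₁ - z₂| ‖w‖₁`. Diagonal positivity says that `s` dominates the kernel of `R²`,
with `R` the operator of a kernel `r`, so that all neighbours of a common point see each other.
Around such a point, small defects make the `w_x` nearly parallel to their average `V`, and the `e_x w̄_x`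
nearly parallel to `V̄`; this forces `e` to be near `1` unless `w` is small
(`sq_integral_le_defect`). Since `|1 - e| ≥ Im m₁ / |m₁| + Im m₂ / |m₂|`, the result is
`‖w‖₁ ≲ |z₁ - z₂| / (Im m₁ + Im m₂)²` (`IsStep.integral_norm_sub_le`), where uniform primitivity
makes the imaginary parts comparable over `x` (`exists_im_solution_le`).

At distance `|z₁ - z₂| ≤ h ≤ Im z₁, Im z₂` either `Im m₁ + Im m₂ ≥ h^{1/3}` somewhere and the
stability bound gives `|w| ≲ h^{1/3}`, or `t ≤ h^{1/3}` and the Schwarz–Pick inequality does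
(`exists_norm_sub_le_of_scale`). Points closer to the real line are raised by doubling their height
(`exists_holder_solution`), and the extension to the closed half-plane is the limit from above.
-/

/-! ### Bounded measurable functions -/

namespace QVE

/-- A bounded measurable function, with no restriction on its values. -/
abbrev BddMeas {A E : Type*} [MeasurableSpace A] [NormedAddCommGroup E] [MeasurableSpace E]
    (f : A → E) : Prop :=
  IsBoundedMeasurable Set.univ f

namespace BddMeas

variable {A B : Type*} [MeasurableSpace A] [MeasurableSpace B]

lemma mk' {E : Type*} [NormedAddCommGroup E] [MeasurableSpace E] {f : A → E} {C : ℝ}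
    (hf : Measurable f) (hC : ∀ t, ‖f t‖ ≤ C) : BddMeas f :=
  ⟨hf, fun _ => Set.mem_univ _, C, hC⟩

lemma of {E : Type*} [NormedAddCommGroup E] [MeasurableSpace E] {D : Set E} {f : A → E}
    (hf : IsBoundedMeasurable D f) : BddMeas f :=
  ⟨hf.measurable, fun _ => Set.mem_univ _, hf.bounded⟩

lemma exists_bound {E : Type*} [NormedAddCommGroup E] [MeasurableSpace E] {f : A → E}
    (hf : BddMeas f) : ∃ C : ℝ, 0 < C ∧ ∀ t, ‖f t‖ ≤ C := by
  obtain ⟨C, hC⟩ := hf.bounded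
  exact ⟨max C 1, by positivity, fun t => (hC t).trans (le_max_left _ _)⟩

lemma const {E : Type*} [NormedAddCommGroup E] [MeasurableSpace E] (c : E) :
    BddMeas (fun _ : A => c) :=
  mk' measurable_const fun _ => le_rfl

lemma comp {E : Type*} [NormedAddCommGroup E] [MeasurableSpace E] {f : B → E}
    (hf : BddMeas f) {g : A → B} (hg : Measurable g) : BddMeas (fun a => f (g a)) := by
  obtain ⟨C, hC⟩ := hf.bounded
  exact mk' (hf.measurable.comp hg) fun t => hC (g t)

lemma add {E : Type*} [NormedAddCommGroup E] [MeasurableSpace E] [MeasurableAdd₂ E]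
    {f g : A → E} (hf : BddMeas f) (hg : BddMeas g) : BddMeas (fun a => f a + g a) := by
  obtain ⟨C, hC⟩ := hf.bounded
  obtain ⟨D, hD⟩ := hg.bounded
  exact mk' (hf.measurable.add hg.measurable)
    fun t => (norm_add_le _ _).trans (add_le_add (hC t) (hD t))

lemma sub {E : Type*} [NormedAddCommGroup E] [MeasurableSpace E] [MeasurableSub₂ E]
    {f g : A → E} (hf : BddMeas f) (hg : BddMeas g) : BddMeas (fun a => f a - g a) := by
  obtain ⟨C, hC⟩ := hf.bounded
  obtain ⟨D, hD⟩ := hg.bounded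
  exact mk' (hf.measurable.sub hg.measurable)
    fun t => (norm_sub_le _ _).trans (add_le_add (hC t) (hD t))

lemma mul {E : Type*} [NormedRing E] [MeasurableSpace E] [MeasurableMul₂ E]
    {f g : A → E} (hf : BddMeas f) (hg : BddMeas g) : BddMeas (fun a => f a * g a) := by
  obtain ⟨C, hC0, hC⟩ := hf.exists_bound
  obtain ⟨D, -, hD⟩ := hg.exists_bound
  exact mk' (hf.measurable.mul hg.measurable)
    fun t => (norm_mul_le _ _).trans
      (mul_le_mul (hC t) (hD t) (norm_nonneg _) hC0.le)

lemma norm {E : Type*} [NormedAddCommGroup E] [MeasurableSpace E] [OpensMeasurableSpace E]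
    {f : A → E} (hf : BddMeas f) : BddMeas (fun a => ‖f a‖) := by
  obtain ⟨C, hC⟩ := hf.bounded
  exact mk' hf.measurable.norm fun t => by simpa using hC t

lemma pow {f : A → ℝ} (hf : BddMeas f) : BddMeas (fun a => f a ^ 2) := by
  simpa only [sq] using hf.mul hf

lemma sqrt {f : A → ℝ} (hf : BddMeas f) : BddMeas (fun a => √(f a)) := by
  obtain ⟨C, -, hC⟩ := hf.exists_bound
  refine mk' (C := √C) hf.measurable.sqrt fun t => ?_
  rw [Real.norm_of_nonneg (Real.sqrt_nonneg _)]
  exact Real.sqrt_le_sqrt ((le_abs_self _).trans (hC t))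

lemma inv {f : A → ℝ} (hf : BddMeas f) {c : ℝ} (hc : 0 < c) (h : ∀ a, c ≤ f a) :
    BddMeas (fun a => (f a)⁻¹) := by
  refine mk' (C := c⁻¹) hf.measurable.inv fun t => ?_
  rw [Real.norm_of_nonneg (inv_nonneg.2 (hc.le.trans (h t)))]
  exact inv_anti₀ hc (h t)

lemma ofReal {f : A → ℝ} (hf : BddMeas f) : BddMeas (fun a => (f a : ℂ)) := by
  obtain ⟨C, hC⟩ := hf.bounded
  exact mk' (Complex.measurable_ofReal.comp hf.measurable) fun t => by simpa using hC t

lemma re {f : A → ℂ} (hf : BddMeas f) : BddMeas (fun a => (f a).re) := by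
  obtain ⟨C, hC⟩ := hf.bounded
  exact mk' (Complex.measurable_re.comp hf.measurable)
    fun t => (Complex.abs_re_le_norm _).trans (hC t)

lemma im {f : A → ℂ} (hf : BddMeas f) : BddMeas (fun a => (f a).im) := by
  obtain ⟨C, hC⟩ := hf.bounded
  exact mk' (Complex.measurable_im.comp hf.measurable)
    fun t => (Complex.abs_im_le_norm _).trans (hC t)

lemma star {f : A → ℂ} (hf : BddMeas f) : BddMeas (fun a => (starRingEnd ℂ) (f a)) := by
  obtain ⟨C, hC⟩ := hf.bounded
  exact mk' (Complex.continuous_conj.measurable.comp hf.measurable) fun t => by simpa using hC t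

section Integral

variable {E : Type*} [NormedAddCommGroup E] [MeasurableSpace E] [BorelSpace E]
  [SecondCountableTopology E] {μ : Measure A} [IsFiniteMeasure μ]
  {ν : Measure B} [IsFiniteMeasure ν]

lemma integrable {f : A → E} (hf : BddMeas f) : Integrable f μ := by
  obtain ⟨C, hC⟩ := hf.bounded
  exact .of_bound hf.measurable.aestronglyMeasurable C (ae_of_all _ hC)

lemma integral [NormedSpace ℝ E] {f : A → B → E} (hf : BddMeas (fun p : A × B => f p.1 p.2)) :
    BddMeas (fun a => ∫ b, f a b ∂ν) := by
  obtain ⟨C, hC⟩ := hf.bounded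
  refine mk' (C := C * ν.real Set.univ) ?_ fun a => ?_
  · exact (StronglyMeasurable.integral_prod_right (f := f)
      hf.measurable.stronglyMeasurable).measurable
  · exact norm_integral_le_of_norm_le_const (ae_of_all _ fun b => hC (a, b))

lemma integral_swap [NormedSpace ℝ E] {f : A → B → E}
    (hf : BddMeas (fun p : A × B => f p.1 p.2)) :
    ∫ a, ∫ b, f a b ∂ν ∂μ = ∫ b, ∫ a, f a b ∂μ ∂ν :=
  integral_integral_swap hf.integrable

end Integral

end BddMeas

section Integrals

variable {A : Type*} [MeasurableSpace A] {μ : Measure A} [IsFiniteMeasure μ]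

/-- The Cauchy–Schwarz inequality for bounded measurable functions. -/
lemma sq_integral_mul_le {f g : A → ℝ} (hf : BddMeas f) (hg : BddMeas g) :
    (∫ x, f x * g x ∂μ) ^ 2 ≤ (∫ x, f x ^ 2 ∂μ) * ∫ x, g x ^ 2 ∂μ := by
  have key : ∀ t : ℝ, 0 ≤ (∫ x, f x ^ 2 ∂μ) * (t * t) + (2 * ∫ x, f x * g x ∂μ) * t
      + ∫ x, g x ^ 2 ∂μ := by
    intro t
    have h : ∫ x, (t * f x + g x) ^ 2 ∂μ
        = (∫ x, f x ^ 2 ∂μ) * (t * t) + (2 * ∫ x, f x * g x ∂μ) * t + ∫ x, g x ^ 2 ∂μ := by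
      have e : ∀ x, (t * f x + g x) ^ 2
          = (t * t) * f x ^ 2 + (2 * t) * (f x * g x) + g x ^ 2 := fun x => by ring
      simp_rw [e]
      have h1 : Integrable (fun x => (t * t) * f x ^ 2) μ := hf.pow.integrable.const_mul _
      have h2 : Integrable (fun x => (2 * t) * (f x * g x)) μ :=
        (hf.mul hg).integrable.const_mul _
      have h12 : Integrable (fun x => (t * t) * f x ^ 2 + (2 * t) * (f x * g x)) μ := h1.add h2
      rw [integral_add h12 hg.pow.integrable, integral_add h1 h2, integral_const_mul,
        integral_const_mul]
      ring
    rw [← h]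
    exact integral_nonneg fun x => sq_nonneg _
  have := discrim_le_zero key
  rw [discrim] at this
  linarith

lemma sq_integral_le {f : A → ℝ} (hf : BddMeas f) :
    (∫ x, f x ∂μ) ^ 2 ≤ μ.real Set.univ * ∫ x, f x ^ 2 ∂μ := by
  simpa [mul_comm] using sq_integral_mul_le (μ := μ) hf (.const 1)

end Integrals

/-! ### Integral operators with non-negative symmetric kernels -/

section Kernel

variable {X : Type*} [MeasurableSpace X] {π : Measure X}
  {s : X → X → ℝ}

/-- The integral operator with kernel `s`, acting on real-valued functions. -/
noncomputable def realOp (π : Measure X) (s : X → X → ℝ) (w : X → ℝ) (x : X) : ℝ :=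
  ∫ y, s x y * w y ∂π

namespace IsKernel

lemma nonneg (hs : IsKernel s) (x y : X) : 0 ≤ s x y := hs.bddMeas.mem (x, y)

lemma bdd (hs : IsKernel s) : BddMeas (fun p : X × X => s p.1 p.2) := .of hs.bddMeas

lemma row (hs : IsKernel s) (x : X) : BddMeas (s x) := hs.bdd.comp measurable_prodMk_left

lemma exists_bound (hs : IsKernel s) : ∃ C : ℝ, 0 < C ∧ ∀ x y, s x y ≤ C := by
  obtain ⟨C, h0, hC⟩ := hs.bdd.exists_bound
  exact ⟨C, h0, fun x y => (le_abs_self _).trans (hC (x, y))⟩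

lemma realOp_nonneg (hs : IsKernel s) {w : X → ℝ} (h : ∀ x, 0 ≤ w x) (x : X) :
    0 ≤ realOp π s w x :=
  integral_nonneg fun y => mul_nonneg (hs.nonneg x y) (h y)

lemma norm_intOp_le (hs : IsKernel s) (w : X → ℂ) (x : X) :
    ‖intOp π s w x‖ ≤ realOp π s (fun y => ‖w y‖) x := by
  refine (norm_integral_le_integral_norm _).trans (le_of_eq ?_)
  simp [realOp, abs_of_nonneg (hs.nonneg x _)]

variable [IsFiniteMeasure π]

lemma realOp_bdd (hs : IsKernel s) {w : X → ℝ} (hw : BddMeas w) : BddMeas (realOp π s w) :=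
  BddMeas.integral (hs.bdd.mul (hw.comp measurable_snd))

lemma intOp_bdd (hs : IsKernel s) {w : X → ℂ} (hw : BddMeas w) : BddMeas (intOp π s w) :=
  BddMeas.integral (hs.bdd.ofReal.mul (hw.comp measurable_snd))

lemma realOp_mono (hs : IsKernel s) {v w : X → ℝ} (hv : BddMeas v) (hw : BddMeas w)
    (h : ∀ x, v x ≤ w x) (x : X) : realOp π s v x ≤ realOp π s w x :=
  integral_mono ((hs.row x).mul hv).integrable ((hs.row x).mul hw).integrable
    fun y => mul_le_mul_of_nonneg_left (h y) (hs.nonneg x y)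

lemma realOp_le_integral (hs : IsKernel s) {C : ℝ} (hC : ∀ x y, s x y ≤ C) {w : X → ℝ}
    (hw : BddMeas w) (h : ∀ x, 0 ≤ w x) (x : X) : realOp π s w x ≤ C * ∫ y, w y ∂π := by
  rw [← integral_const_mul]
  exact integral_mono ((hs.row x).mul hw).integrable (hw.integrable.const_mul C)
    fun y => mul_le_mul_of_nonneg_right (hC x y) (h y)

lemma realOp_le_const (hs : IsKernel s) {C D : ℝ} (hC : ∀ x y, s x y ≤ C) (hC0 : 0 ≤ C)
    {w : X → ℝ} (hw : BddMeas w) (h : ∀ x, 0 ≤ w x) (hD : ∀ x, w x ≤ D) (x : X) :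
    realOp π s w x ≤ C * (D * π.real Set.univ) := by
  refine (hs.realOp_le_integral hC hw h x).trans (mul_le_mul_of_nonneg_left ?_ hC0)
  calc ∫ y, w y ∂π ≤ ∫ _, D ∂π := integral_mono hw.integrable (integrable_const _) hD
    _ = D * π.real Set.univ := by simp [mul_comm]

lemma im_intOp (hs : IsKernel s) {w : X → ℂ} (hw : BddMeas w) (x : X) :
    (intOp π s w x).im = realOp π s (fun y => (w y).im) x := by
  have h : Integrable (fun y => (s x y : ℂ) * w y) π := ((hs.row x).ofReal.mul hw).integrable
  have := integral_im h
  simp only [RCLike.im_to_complex] at this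
  rw [intOp, ← this, realOp]
  simp

lemma intOp_sub (hs : IsKernel s) {v w : X → ℂ} (hv : BddMeas v) (hw : BddMeas w) (x : X) :
    intOp π s v x - intOp π s w x = intOp π s (fun y => v y - w y) x := by
  rw [intOp, intOp, intOp, ← integral_sub ((hs.row x).ofReal.mul hv).integrable
    ((hs.row x).ofReal.mul hw).integrable]
  simp [mul_sub]

/-- Cauchy–Schwarz for the operator: the average of a geometric mean is at most the geometric mean of
the averages. -/
lemma sq_realOp_sqrt_le (hs : IsKernel s) {v w : X → ℝ} (hv : BddMeas v) (hw : BddMeas w)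
    (hv0 : ∀ x, 0 ≤ v x) (hw0 : ∀ x, 0 ≤ w x) (x : X) :
    realOp π s (fun y => √(v y * w y)) x ^ 2 ≤ realOp π s v x * realOp π s w x := by
  have h := sq_integral_mul_le (μ := π) ((hs.row x).mul hv).sqrt ((hs.row x).mul hw).sqrt
  have e1 : ∀ y, √(s x y * v y) * √(s x y * w y) = s x y * √(v y * w y) := fun y => by
    rw [← Real.sqrt_mul (mul_nonneg (hs.nonneg x y) (hv0 y)),
      show s x y * v y * (s x y * w y) = s x y ^ 2 * (v y * w y) by ring,
      Real.sqrt_mul (sq_nonneg _), Real.sqrt_sq (hs.nonneg x y)]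
  have e2 : ∀ y, √(s x y * v y) ^ 2 = s x y * v y := fun y =>
    Real.sq_sqrt (mul_nonneg (hs.nonneg x y) (hv0 y))
  have e3 : ∀ y, √(s x y * w y) ^ 2 = s x y * w y := fun y =>
    Real.sq_sqrt (mul_nonneg (hs.nonneg x y) (hw0 y))
  simp only [e1, e2, e3] at h
  exact h

/-- Schur test: a positive function `t` with `S t ≤ b t` bounds the quadratic form of `S` by the
multiplication operator `b`. -/
lemma schur_test (hs : IsKernel s) {t b w : X → ℝ} (ht : BddMeas t) (hb : BddMeas b)
    (hw : BddMeas w) {c : ℝ} (hc : 0 < c) (hct : ∀ x, c ≤ t x)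
    (h : ∀ x, realOp π s t x ≤ b x * t x) :
    ∫ x, ∫ y, s x y * (w x * w y) ∂π ∂π ≤ ∫ x, b x * w x ^ 2 ∂π := by
  have htp : ∀ x, 0 < t x := fun x => hc.trans_le (hct x)
  have hti := ht.inv hc hct
  have hs' := hs.bdd
  have fst {f : X → ℝ} (hf : BddMeas f) : BddMeas (fun p : X × X => f p.1) :=
    hf.comp measurable_fst
  have snd {f : X → ℝ} (hf : BddMeas f) : BddMeas (fun p : X × X => f p.2) :=
    hf.comp measurable_snd
  set G : X → X → ℝ := fun x y => s x y * (w x ^ 2 * (t x)⁻¹ * t y) with hG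
  have hGb : BddMeas (fun p : X × X => G p.1 p.2) :=
    hs'.mul (((fst hw.pow).mul (fst hti)).mul (snd ht))
  have hGs : BddMeas (fun p : X × X => G p.2 p.1) := hGb.comp measurable_swap
  have hWb : BddMeas (fun p : X × X => s p.1 p.2 * (w p.1 * w p.2)) :=
    hs'.mul ((fst hw).mul (snd hw))
  have hp : ∀ x y, s x y * (w x * w y) ≤ (1 / 2) * (G x y + G y x) := by
    intro x y
    have h1 : w x * w y ≤ (1 / 2) * (w x ^ 2 * (t x)⁻¹ * t y + w y ^ 2 * (t y)⁻¹ * t x) := by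
      have e : (1 / 2) * (w x ^ 2 * (t x)⁻¹ * t y + w y ^ 2 * (t y)⁻¹ * t x) - w x * w y
          = (1 / 2) * (t x * t y) * (w x / t x - w y / t y) ^ 2 := by
        have := (htp x).ne'
        have := (htp y).ne'
        field_simp
        ring
      have : 0 ≤ (1 / 2) * (t x * t y) * (w x / t x - w y / t y) ^ 2 := by
        have := htp x
        have := htp y
        positivity
      linarith
    have h2 := mul_le_mul_of_nonneg_left h1 (hs.nonneg x y)
    simp only [hG, hs.symm y x]
    linarith
  have hrow {F : X → X → ℝ} (hF : BddMeas (fun p : X × X => F p.1 p.2)) (x : X) :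
      Integrable (F x) π := (hF.comp measurable_prodMk_left).integrable
  have hint {F : X → X → ℝ} (hF : BddMeas (fun p : X × X => F p.1 p.2)) :
      Integrable (fun x => ∫ y, F x y ∂π) π := hF.integral.integrable
  calc ∫ x, ∫ y, s x y * (w x * w y) ∂π ∂π
      ≤ ∫ x, ∫ y, (1 / 2) * (G x y + G y x) ∂π ∂π := by
        have hR : BddMeas (fun p : X × X => (1 / 2) * (G p.1 p.2 + G p.2 p.1)) :=
          (BddMeas.const _).mul (hGb.add hGs)
        exact integral_mono (hint (F := fun x y => s x y * (w x * w y)) hWb)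
          (hint (F := fun x y => (1 / 2) * (G x y + G y x)) hR)
          fun x => integral_mono (hrow (F := fun x y => s x y * (w x * w y)) hWb x)
            (hrow (F := fun x y => (1 / 2) * (G x y + G y x)) hR x) fun y => hp x y
    _ = (1 / 2) * (∫ x, ∫ y, G x y ∂π ∂π + ∫ x, ∫ y, G y x ∂π ∂π) := by
        rw [← integral_add (hint hGb) (hint (F := fun x y => G y x) hGs), ← integral_const_mul]
        refine integral_congr_ae (ae_of_all _ fun x => ?_)
        simp only
        rw [integral_const_mul, integral_add (hrow hGb x) (hrow (F := fun x y => G y x) hGs x)]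
    _ = ∫ x, ∫ y, G x y ∂π ∂π := by
        rw [← BddMeas.integral_swap hGb]
        ring
    _ ≤ ∫ x, b x * w x ^ 2 ∂π := by
        refine integral_mono (hint hGb) (hb.mul hw.pow).integrable fun x => ?_
        have e : ∫ y, G x y ∂π = w x ^ 2 * (t x)⁻¹ * realOp π s t x := by
          rw [realOp, ← integral_const_mul]
          exact integral_congr_ae (ae_of_all _ fun y => by simp only [hG]; ring)
        simp only
        rw [e]
        have h0 : 0 ≤ w x ^ 2 * (t x)⁻¹ := by
          have := htp x
          positivity
        calc w x ^ 2 * (t x)⁻¹ * realOp π s t x ≤ w x ^ 2 * (t x)⁻¹ * (b x * t x) :=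
              mul_le_mul_of_nonneg_left (h x) h0
          _ = b x * w x ^ 2 := by
              have := (htp x).ne'
              field_simp

end IsKernel

end Kernel

end QVE

/-! ### The fixed point map of the quadratic vector equation -/

namespace QVE

variable {X : Type*} [MeasurableSpace X]

/-- `n` is the image of `u` under the fixed point map `u ↦ -1 / (z + a + S u)` of the quadratic
vector equation. Solutions are the fixed points; Picard iterates satisfy this with `n ≠ u`. -/
def IsStep (π : Measure X) (a : X → ℝ) (s : X → X → ℝ) (z : ℍ) (u n : X → ℂ) : Prop :=
  ∀ x, -(1 / n x) = (z : ℂ) + (a x : ℂ) + intOp π s u x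

lemma IsSolution.isStep {π : Measure X} {a : X → ℝ} {s : X → X → ℝ} {m : ℍ → X → ℂ}
    (hm : IsSolution π a s m) (z : ℍ) : IsStep π a s z (m z) (m z) :=
  hm.eqn z

variable {π : Measure X} [IsFiniteMeasure π] {a : X → ℝ} {s : X → X → ℝ}

namespace IsStep

variable {z z₁ z₂ : ℍ} {u u₁ u₂ n n₁ n₂ : X → ℂ}

lemma im_rhs (hs : IsKernel s) (hu : BddMeas u) (x : X) :
    ((z : ℂ) + (a x : ℂ) + intOp π s u x).im = z.im + realOp π s (fun y => (u y).im) x := by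
  simp [hs.im_intOp hu x]

lemma ne_zero (hs : IsKernel s) (hu : IsBoundedMeasurable {w : ℂ | 0 < w.im} u)
    (h : IsStep π a s z u n) (x : X) : n x ≠ 0 := by
  intro h0
  have h1 := congrArg Complex.im (h x)
  rw [im_rhs hs (.of hu), h0] at h1
  have := hs.realOp_nonneg (π := π) (fun y => (hu.mem y).le) x
  have := z.im_pos
  simp at h1
  linarith

/-- The imaginary part of the equation. -/
lemma im_eq (hs : IsKernel s) (hu : IsBoundedMeasurable {w : ℂ | 0 < w.im} u)
    (h : IsStep π a s z u n) (x : X) :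
    (n x).im = ‖n x‖ ^ 2 * (z.im + realOp π s (fun y => (u y).im) x) := by
  have hn := h.ne_zero hs hu x
  rw [← im_rhs hs (.of hu), ← h x, Complex.sq_norm]
  have : Complex.normSq (n x) ≠ 0 := by simpa using hn
  simp only [one_div, Complex.neg_im, Complex.inv_im]
  field_simp

lemma im_pos (hs : IsKernel s) (hu : IsBoundedMeasurable {w : ℂ | 0 < w.im} u)
    (h : IsStep π a s z u n) (x : X) : 0 < (n x).im := by
  rw [h.im_eq hs hu]
  have h1 := hs.realOp_nonneg (π := π) (fun y => (hu.mem y).le) x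
  have h2 := z.im_pos
  have h3 := norm_pos_iff.2 (h.ne_zero hs hu x)
  positivity

lemma norm_le (hs : IsKernel s) (hu : IsBoundedMeasurable {w : ℂ | 0 < w.im} u)
    (h : IsStep π a s z u n) (x : X) : ‖n x‖ ≤ z.im⁻¹ := by
  have h0 := norm_pos_iff.2 (h.ne_zero hs hu x)
  have h1 := h.im_eq hs hu x
  have h2 := hs.realOp_nonneg (π := π) (fun y => (hu.mem y).le) x
  have h3 := (le_abs_self _).trans (Complex.abs_im_le_norm (n x))
  have h4 := z.im_pos
  have h5 : ‖n x‖ ^ 2 * z.im ≤ ‖n x‖ := by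
    have := mul_nonneg (sq_nonneg ‖n x‖) h2
    nlinarith
  rw [← one_div, le_div_iff₀ h4]
  nlinarith

lemma le_norm (hs : IsKernel s) (hu : IsBoundedMeasurable {w : ℂ | 0 < w.im} u)
    (h : IsStep π a s z u n) {A C U : ℝ} (hA : ∀ x, |a x| ≤ A) (hC : ∀ x y, s x y ≤ C)
    (hC0 : 0 ≤ C) (hU : ∀ x, ‖u x‖ ≤ U) (x : X) :
    (‖(z : ℂ)‖ + A + C * (U * π.real Set.univ))⁻¹ ≤ ‖n x‖ := by
  have h0 := norm_pos_iff.2 (h.ne_zero hs hu x)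
  have h1 : ‖n x‖⁻¹ ≤ ‖(z : ℂ)‖ + A + C * (U * π.real Set.univ) := by
    have e : ‖n x‖⁻¹ = ‖-(1 / n x)‖ := by simp
    rw [e, h x]
    refine (norm_add_le _ _).trans (add_le_add ((norm_add_le _ _).trans ?_) ?_)
    · simpa using hA x
    · exact (hs.norm_intOp_le _ _).trans (hs.realOp_le_const hC hC0
        (BddMeas.of hu).norm (fun _ => norm_nonneg _) hU x)
  exact inv_le_of_inv_le₀ h0 h1

lemma exists_le_im (ha : BddMeas a) (hs : IsKernel s)
    (hu : IsBoundedMeasurable {w : ℂ | 0 < w.im} u) (h : IsStep π a s z u n) :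
    ∃ c : ℝ, 0 < c ∧ ∀ x, c ≤ (n x).im := by
  obtain ⟨A, hA0, hA⟩ := ha.exists_bound
  obtain ⟨C, hC0, hC⟩ := hs.exists_bound
  obtain ⟨U, hU0, hU⟩ := (BddMeas.of hu).exists_bound
  have hz := z.im_pos
  refine ⟨(‖(z : ℂ)‖ + A + C * (U * π.real Set.univ))⁻¹ ^ 2 * z.im, by positivity, fun x => ?_⟩
  rw [h.im_eq hs hu x]
  have := hs.realOp_nonneg (π := π) (fun y => (hu.mem y).le) x
  exact mul_le_mul (pow_le_pow_left₀ (by positivity)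
    (h.le_norm hs hu hA hC hC0.le hU x) 2) (by linarith) hz.le (by positivity)

lemma measurable (ha : BddMeas a) (hs : IsKernel s) (hu : BddMeas u)
    (h : IsStep π a s z u n) : Measurable n := by
  have e : n = fun x => -((z : ℂ) + (a x : ℂ) + intOp π s u x)⁻¹ := by
    funext x
    rw [← h x]
    simp
  rw [e]
  exact (((measurable_const).add ha.ofReal.measurable).add
    (hs.intOp_bdd hu).measurable).inv.neg

lemma bddMeas (ha : BddMeas a) (hs : IsKernel s)
    (hu : IsBoundedMeasurable {w : ℂ | 0 < w.im} u) (h : IsStep π a s z u n) :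
    IsBoundedMeasurable {w : ℂ | 0 < w.im} n :=
  ⟨h.measurable ha hs (.of hu), h.im_pos hs hu, _, h.norm_le hs hu⟩

lemma sub_eq (hs : IsKernel s) (hu₁ : IsBoundedMeasurable {w : ℂ | 0 < w.im} u₁)
    (hu₂ : IsBoundedMeasurable {w : ℂ | 0 < w.im} u₂) (h₁ : IsStep π a s z₁ u₁ n₁)
    (h₂ : IsStep π a s z₂ u₂ n₂) (x : X) :
    n₁ x - n₂ x = n₁ x * n₂ x * ((z₁ : ℂ) - z₂ + intOp π s (fun y => u₁ y - u₂ y) x) := by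
  rw [← hs.intOp_sub (.of hu₁) (.of hu₂)]
  have e1 := h₁ x
  have e2 := h₂ x
  have n1 := h₁.ne_zero hs hu₁ x
  have n2 := h₂.ne_zero hs hu₂ x
  have e : (z₁ : ℂ) - z₂ + (intOp π s u₁ x - intOp π s u₂ x) = -(1 / n₁ x) - -(1 / n₂ x) := by
    rw [e1, e2]
    ring
  rw [e]
  field_simp
  ring

/-- The geometric mean of the imaginary parts is a supersolution of the linearised equation. -/
lemma le_sqrt_im (hs : IsKernel s) (hu₁ : IsBoundedMeasurable {w : ℂ | 0 < w.im} u₁)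
    (hu₂ : IsBoundedMeasurable {w : ℂ | 0 < w.im} u₂) (h₁ : IsStep π a s z₁ u₁ n₁)
    (h₂ : IsStep π a s z₂ u₂ n₂) (x : X) :
    ‖n₁ x‖ * ‖n₂ x‖ * (√(z₁.im * z₂.im) + realOp π s (fun y => √((u₁ y).im * (u₂ y).im)) x)
      ≤ √((n₁ x).im * (n₂ x).im) := by
  have r1 := hs.realOp_nonneg (π := π) (fun y => (hu₁.mem y).le) x
  have r2 := hs.realOp_nonneg (π := π) (fun y => (hu₂.mem y).le) x
  have rt := hs.realOp_nonneg (π := π) (w := fun y => √((u₁ y).im * (u₂ y).im))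
    (fun y => Real.sqrt_nonneg _) x
  have cs := hs.sq_realOp_sqrt_le (π := π) (BddMeas.of hu₁).im (BddMeas.of hu₂).im
    (fun y => (hu₁.mem y).le) (fun y => (hu₂.mem y).le) x
  rw [h₁.im_eq hs hu₁, h₂.im_eq hs hu₂]
  have z1 := z₁.im_pos
  have z2 := z₂.im_pos
  set A := realOp π s (fun y => (u₁ y).im) x
  set B := realOp π s (fun y => (u₂ y).im) x
  set T := realOp π s (fun y => √((u₁ y).im * (u₂ y).im)) x
  apply Real.le_sqrt_of_sq_le
  have e : ‖n₁ x‖ ^ 2 * (z₁.im + A) * (‖n₂ x‖ ^ 2 * (z₂.im + B))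
      = (‖n₁ x‖ * ‖n₂ x‖) ^ 2 * ((z₁.im + A) * (z₂.im + B)) := by ring
  rw [e, mul_pow]
  refine mul_le_mul_of_nonneg_left ?_ (sq_nonneg _)
  set q := √(z₁.im * z₂.im)
  have hq : q ^ 2 = z₁.im * z₂.im := Real.sq_sqrt (by positivity)
  have hq0 : 0 ≤ q := Real.sqrt_nonneg _
  have h2 : 2 * (q * T) ≤ z₁.im * B + A * z₂.im := by
    refine abs_le_of_sq_le_sq' ?_ (by positivity) |>.2
    calc (2 * (q * T)) ^ 2 = 4 * (q ^ 2 * T ^ 2) := by ring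
      _ ≤ 4 * ((z₁.im * z₂.im) * (A * B)) := by
        rw [hq]
        have : 0 ≤ z₁.im * z₂.im := by positivity
        nlinarith [mul_le_mul_of_nonneg_left cs this]
      _ ≤ (z₁.im * B + A * z₂.im) ^ 2 := by
        nlinarith [sq_nonneg (z₁.im * B - A * z₂.im)]
  nlinarith

/-- The fixed point map contracts differences measured relative to the geometric mean of the
imaginary parts. The part `Q₀` accounts for the distance of the spectral parameters; only the
excess `Q` over it is contracted. -/
lemma contraction (hs : IsKernel s) (hu₁ : IsBoundedMeasurable {w : ℂ | 0 < w.im} u₁)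
    (hu₂ : IsBoundedMeasurable {w : ℂ | 0 < w.im} u₂) (h₁ : IsStep π a s z₁ u₁ n₁)
    (h₂ : IsStep π a s z₂ u₂ n₂) {Q₀ Q M : ℝ} (hQ : 0 ≤ Q)
    (hz : ‖(z₁ : ℂ) - z₂‖ ≤ Q₀ * √(z₁.im * z₂.im))
    (hM : ∀ x, realOp π s (fun y => √((u₁ y).im * (u₂ y).im)) x ≤ M)
    (hd : ∀ x, ‖u₁ x - u₂ x‖ ≤ (Q₀ + Q) * √((u₁ x).im * (u₂ x).im)) (x : X) :
    ‖n₁ x - n₂ x‖ ≤ (Q₀ + M / (√(z₁.im * z₂.im) + M) * Q) * √((n₁ x).im * (n₂ x).im) := by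
  have ht : BddMeas (fun y => √((u₁ y).im * (u₂ y).im)) :=
    ((BddMeas.of hu₁).im.mul (BddMeas.of hu₂).im).sqrt
  have hT0 := hs.realOp_nonneg (π := π) (w := fun y => √((u₁ y).im * (u₂ y).im))
    (fun y => Real.sqrt_nonneg _) x
  have hT := hM x
  have key := le_sqrt_im hs hu₁ hu₂ h₁ h₂ x
  have hS : ‖intOp π s (fun y => u₁ y - u₂ y) x‖
      ≤ (Q₀ + Q) * realOp π s (fun y => √((u₁ y).im * (u₂ y).im)) x := by
    refine (hs.norm_intOp_le _ _).trans ((hs.realOp_mono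
      ((BddMeas.of hu₁).sub (BddMeas.of hu₂)).norm ((BddMeas.const _).mul ht) hd x).trans
      (le_of_eq ?_))
    rw [realOp, realOp, ← integral_const_mul]
    exact integral_congr_ae (ae_of_all _ fun y => by ring)
  have hq : 0 < √(z₁.im * z₂.im) := Real.sqrt_pos.2 (mul_pos z₁.im_pos z₂.im_pos)
  rw [sub_eq hs hu₁ hu₂ h₁ h₂, norm_mul, norm_mul]
  set T := realOp π s (fun y => √((u₁ y).im * (u₂ y).im)) x
  set q := √(z₁.im * z₂.im)
  have hM0 : 0 ≤ M := hT0.trans hT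
  have hQ0 : 0 ≤ Q₀ := by
    by_contra! hneg
    have := norm_nonneg ((z₁ : ℂ) - z₂)
    nlinarith
  -- `T / (q + T)` is increasing in `T`
  have hmono : T ≤ M / (q + M) * (q + T) := by
    rw [div_mul_eq_mul_div, le_div_iff₀ (by positivity)]
    nlinarith
  calc ‖n₁ x‖ * ‖n₂ x‖ * ‖(z₁ : ℂ) - z₂ + intOp π s (fun y => u₁ y - u₂ y) x‖
      ≤ ‖n₁ x‖ * ‖n₂ x‖ * ((Q₀ + M / (q + M) * Q) * (q + T)) := by
        refine mul_le_mul_of_nonneg_left ?_ (by positivity)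
        refine (norm_add_le _ _).trans ((add_le_add hz hS).trans ?_)
        nlinarith [mul_le_mul_of_nonneg_right hmono hQ]
    _ = (Q₀ + M / (q + M) * Q) * (‖n₁ x‖ * ‖n₂ x‖ * (q + T)) := by ring
    _ ≤ _ := mul_le_mul_of_nonneg_left key (by positivity)

end IsStep

/-! ### Existence and uniqueness of the solution -/

/-- Schwarz–Pick inequality for two solutions of the equation at two spectral parameters. -/
lemma norm_sub_le_of_isStep (ha : BddMeas a) (hs : IsKernel s) {z₁ z₂ : ℍ} {m₁ m₂ : X → ℂ}
    (hm₁ : IsBoundedMeasurable {w : ℂ | 0 < w.im} m₁)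
    (hm₂ : IsBoundedMeasurable {w : ℂ | 0 < w.im} m₂)
    (h₁ : IsStep π a s z₁ m₁ m₁) (h₂ : IsStep π a s z₂ m₂ m₂) (x : X) :
    ‖m₁ x - m₂ x‖ ≤ ‖(z₁ : ℂ) - z₂‖ / √(z₁.im * z₂.im) * √((m₁ x).im * (m₂ x).im) := by
  have hq : 0 < √(z₁.im * z₂.im) := Real.sqrt_pos.2 (mul_pos z₁.im_pos z₂.im_pos)
  obtain ⟨U₁, hU₁0, hU₁⟩ := (BddMeas.of hm₁).exists_bound
  obtain ⟨U₂, hU₂0, hU₂⟩ := (BddMeas.of hm₂).exists_bound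
  have ht : BddMeas (fun y => √((m₁ y).im * (m₂ y).im)) :=
    ((BddMeas.of hm₁).im.mul (BddMeas.of hm₂).im).sqrt
  obtain ⟨M, hM0, hM⟩ := (hs.realOp_bdd (π := π) ht).exists_bound
  set q := √(z₁.im * z₂.im)
  set Q₀ := ‖(z₁ : ℂ) - z₂‖ / q
  set r := M / (q + M)
  have hr0 : 0 ≤ r := by positivity
  have hr1 : r < 1 := (div_lt_one (by positivity)).2 (by linarith)
  -- a starting bound: the geometric mean of the imaginary parts is bounded below
  obtain ⟨l₁, hl₁, low₁⟩ := h₁.exists_le_im ha hs hm₁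
  obtain ⟨l₂, hl₂, low₂⟩ := h₂.exists_le_im ha hs hm₂
  have low : ∀ y, √(l₁ * l₂) ≤ √((m₁ y).im * (m₂ y).im) := fun y =>
    Real.sqrt_le_sqrt (mul_le_mul (low₁ y) (low₂ y) hl₂.le (hm₁.mem y).le)
  set l := √(l₁ * l₂)
  have hl : 0 < l := Real.sqrt_pos.2 (by positivity)
  set Q := (U₁ + U₂) / l
  have hQ0 : 0 ≤ Q₀ := by positivity
  have iter : ∀ k : ℕ, ∀ y, ‖m₁ y - m₂ y‖ ≤ (Q₀ + r ^ k * Q) * √((m₁ y).im * (m₂ y).im) := by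
    intro k
    induction k with
    | zero =>
      intro y
      calc ‖m₁ y - m₂ y‖ ≤ U₁ + U₂ := (norm_sub_le _ _).trans (add_le_add (hU₁ y) (hU₂ y))
        _ = Q * l := by simp only [Q]; field_simp
        _ ≤ (Q₀ + r ^ 0 * Q) * √((m₁ y).im * (m₂ y).im) := by
          refine mul_le_mul ?_ (low y) hl.le (by positivity)
          rw [pow_zero, one_mul]
          linarith
    | succ k ih =>
      intro y
      have := IsStep.contraction hs hm₁ hm₂ h₁ h₂ (Q₀ := Q₀) (Q := r ^ k * Q) (M := M)
        (by positivity) (by simp only [Q₀]; rw [div_mul_cancel₀ _ hq.ne'])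
        (fun y => (le_abs_self _).trans (hM y)) ih y
      convert this using 2
      rw [pow_succ]
      ring
  have lim : Tendsto (fun k : ℕ => (Q₀ + r ^ k * Q) * √((m₁ x).im * (m₂ x).im)) atTop
      (𝓝 ((Q₀ + 0 * Q) * √((m₁ x).im * (m₂ x).im))) :=
    ((tendsto_pow_atTop_nhds_zero_of_lt_one hr0 hr1).mul_const Q |>.const_add Q₀).mul_const _
  have := ge_of_tendsto' lim fun k => iter k x
  simpa using this

/-- Picard iteration from the constant `i` converges uniformly, because the imaginary parts of the
iterates stay bounded and bounded below, so that relative and absolute differences are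
comparable. -/
lemma exists_isStep_self (ha : BddMeas a) (hs : IsKernel s) (z : ℍ) :
    ∃ m : X → ℂ, IsBoundedMeasurable {w : ℂ | 0 < w.im} m ∧ IsStep π a s z m m := by
  obtain ⟨A, hA0, hA⟩ := ha.exists_bound
  obtain ⟨C, hC0, hC⟩ := hs.exists_bound
  have hz := z.im_pos
  let Φ : (X → ℂ) → X → ℂ := fun u x => -((z : ℂ) + (a x : ℂ) + intOp π s u x)⁻¹
  have hΦ : ∀ u, IsStep π a s z u (Φ u) := fun u x => by simp [Φ]
  let u : ℕ → X → ℂ := fun k => Φ^[k] (fun _ => Complex.I)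
  have hu_succ : ∀ k, u (k + 1) = Φ (u k) := fun k => Function.iterate_succ_apply' _ _ _
  have hst : ∀ k, IsStep π a s z (u k) (u (k + 1)) := fun k => hu_succ k ▸ hΦ (u k)
  have hub : ∀ k, IsBoundedMeasurable {w : ℂ | 0 < w.im} (u k) := by
    intro k
    induction k with
    | zero => exact ⟨measurable_const, fun _ => by simp [u], 1, fun _ => by simp [u]⟩
    | succ k ih => exact (hst k).bddMeas ha hs ih
  set U := max 1 z.im⁻¹
  have hU1 : (1 : ℝ) ≤ U := le_max_left _ _
  have hU : ∀ k x, ‖u k x‖ ≤ U := by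
    intro k x
    cases k with
    | zero => simpa [u] using hU1
    | succ k => exact ((hst k).norm_le hs (hub k) x).trans (le_max_right _ _)
  set l := (‖(z : ℂ)‖ + A + C * (U * π.real Set.univ))⁻¹ ^ 2 * z.im
  have hl0 : 0 < l := by positivity
  have hl : ∀ k x, min 1 l ≤ (u k x).im := by
    intro k x
    cases k with
    | zero => simp [u]
    | succ k =>
      refine (min_le_right _ _).trans ?_
      rw [(hst k).im_eq hs (hub k) x]
      have := hs.realOp_nonneg (π := π) (fun y => ((hub k).mem y).le) x
      exact mul_le_mul (pow_le_pow_left₀ (by positivity)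
        ((hst k).le_norm hs (hub k) hA hC hC0.le (hU k) x) 2) (by linarith) hz.le (by positivity)
  set c := min 1 l
  have hc0 : 0 < c := by positivity
  have himU : ∀ k x, (u k x).im ≤ U := fun k x =>
    ((le_abs_self _).trans (Complex.abs_im_le_norm _)).trans (hU k x)
  have ht_le : ∀ k x, √((u (k + 1) x).im * (u k x).im) ≤ U := fun k x => by
    rw [Real.sqrt_le_left (by positivity), sq]
    exact mul_le_mul (himU _ x) (himU _ x) ((hub k).mem x).le (by positivity)
  have le_ht : ∀ k x, c ≤ √((u (k + 1) x).im * (u k x).im) := fun k x => by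
    apply Real.le_sqrt_of_sq_le
    rw [sq]
    exact mul_le_mul (hl _ x) (hl _ x) hc0.le ((hub _).mem x).le
  have ht : ∀ k, BddMeas (fun x => √((u (k + 1) x).im * (u k x).im)) := fun k =>
    ((BddMeas.of (hub _)).im.mul (BddMeas.of (hub _)).im).sqrt
  set M := C * (U * π.real Set.univ)
  set q := √(z.im * z.im)
  have hq : 0 < q := Real.sqrt_pos.2 (by positivity)
  set r := M / (q + M)
  have hM0 : 0 ≤ M := by positivity
  have hr0 : 0 ≤ r := by positivity
  have hr1 : r < 1 := (div_lt_one (by positivity)).2 (by linarith)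
  set Q := 2 * U / c
  have iter : ∀ k x, ‖u (k + 1) x - u k x‖ ≤ r ^ k * Q * √((u (k + 1) x).im * (u k x).im) := by
    intro k
    induction k with
    | zero =>
      intro x
      calc ‖u 1 x - u 0 x‖ ≤ U + U := (norm_sub_le _ _).trans (add_le_add (hU _ x) (hU _ x))
        _ = r ^ 0 * Q * c := by simp only [Q]; field_simp; ring
        _ ≤ _ := mul_le_mul_of_nonneg_left (le_ht 0 x) (by positivity)
    | succ k ih =>
      intro x
      have := IsStep.contraction hs (hub (k + 1)) (hub k) (hst (k + 1)) (hst k) (Q₀ := 0)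
        (Q := r ^ k * Q) (M := M) (by positivity) (by simp)
        (fun x => hs.realOp_le_const hC hC0.le (ht k) (fun y => Real.sqrt_nonneg _) (ht_le k) x)
        (fun x => by simpa using ih x) x
      convert this using 2
      simp only [r, q, pow_succ]
      ring
  have hcauchy : ∀ x, CauchySeq (fun k => u k x) := fun x => by
    refine cauchySeq_of_le_geometric r (Q * U) hr1 fun k => ?_
    rw [dist_comm, dist_eq_norm]
    refine (iter k x).trans ?_
    calc r ^ k * Q * √((u (k + 1) x).im * (u k x).im) ≤ r ^ k * Q * U :=
          mul_le_mul_of_nonneg_left (ht_le k x) (by positivity)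
      _ = Q * U * r ^ k := by ring
  choose m hm using fun x => cauchySeq_tendsto_of_complete (hcauchy x)
  have hmm : Measurable m :=
    measurable_of_tendsto_metrizable (fun k => (hub k).measurable) (tendsto_pi_nhds.2 hm)
  have hmU : ∀ x, ‖m x‖ ≤ U := fun x => le_of_tendsto' (hm x).norm fun k => hU k x
  have hmc : ∀ x, c ≤ (m x).im := fun x =>
    ge_of_tendsto' ((Complex.continuous_im.tendsto _).comp (hm x)) fun k => hl k x
  refine ⟨m, ⟨hmm, fun x => hc0.trans_le (hmc x), U, hmU⟩, fun x => ?_⟩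
  have hmne : m x ≠ 0 := fun h0 => by
    have := hmc x
    rw [h0, Complex.zero_im] at this
    linarith
  have h1 : Tendsto (fun k => intOp π s (u k) x) atTop (𝓝 (intOp π s m x)) := by
    refine tendsto_integral_of_dominated_convergence (fun _ => C * U)
      (fun k => (((hs.row x).ofReal.mul (.of (hub k))).measurable).aestronglyMeasurable)
      (integrable_const _) (fun k => ae_of_all _ fun y => ?_)
      (ae_of_all _ fun y => (hm y).const_mul _)
    rw [norm_mul, Complex.norm_real, Real.norm_of_nonneg (hs.nonneg x y)]
    exact mul_le_mul (hC x y) (hU k y) (norm_nonneg _) hC0.le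
  have h2 : Tendsto (fun k => -(1 / u (k + 1) x)) atTop (𝓝 (-(1 / m x))) :=
    (tendsto_const_nhds.div ((hm x).comp (tendsto_add_atTop_nat 1)) hmne).neg
  have h3 := h1.const_add ((z : ℂ) + (a x : ℂ))
  exact tendsto_nhds_unique h2 (h3.congr fun k => (hst k x).symm)

theorem existsUnique_isSolution (ha : BddMeas a) (hs : IsKernel s) :
    ∃! m : ℍ → X → ℂ, IsSolution π a s m := by
  choose m hb hm using fun z => exists_isStep_self (π := π) ha hs z
  refine ⟨m, ⟨hb, hm⟩, fun m' hm' => ?_⟩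
  funext z x
  have := norm_sub_le_of_isStep ha hs (hm'.bddMeas z) (hb z) (hm'.isStep z) (hm z) x
  rw [sub_self, norm_zero, zero_div, zero_mul, norm_le_zero_iff, sub_eq_zero] at this
  exact this

end QVE

/-! ### Uniform bounds on the solution -/

namespace QVE

variable {X : Type*} [MeasurableSpace X] {π : Measure X} [IsFiniteMeasure π] {a : X → ℝ}
  {s r : X → X → ℝ}

/-- The quadratic form of `S` at `w` is at most that of multiplication by `1 / |m₁ m₂|`. In the
symmetrised picture: the operator `|m₁ m₂|^{1/2} S |m₁ m₂|^{1/2}` has `L²`-norm at most one. -/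
lemma IsStep.integral_kernel_le (ha : BddMeas a) (hs : IsKernel s) {z₁ z₂ : ℍ} {m₁ m₂ : X → ℂ}
    (hm₁ : IsBoundedMeasurable {w : ℂ | 0 < w.im} m₁)
    (hm₂ : IsBoundedMeasurable {w : ℂ | 0 < w.im} m₂)
    (h₁ : IsStep π a s z₁ m₁ m₁) (h₂ : IsStep π a s z₂ m₂ m₂) {w : X → ℝ} (hw : BddMeas w) :
    ∫ x, ∫ y, s x y * (w x * w y) ∂π ∂π ≤ ∫ x, (‖m₁ x‖ * ‖m₂ x‖)⁻¹ * w x ^ 2 ∂π := by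
  obtain ⟨l₁, hl₁, low₁⟩ := h₁.exists_le_im ha hs hm₁
  obtain ⟨l₂, hl₂, low₂⟩ := h₂.exists_le_im ha hs hm₂
  have norm_low : ∀ x, l₁ * l₂ ≤ ‖m₁ x‖ * ‖m₂ x‖ := fun x =>
    mul_le_mul ((low₁ x).trans ((le_abs_self _).trans (Complex.abs_im_le_norm _)))
      ((low₂ x).trans ((le_abs_self _).trans (Complex.abs_im_le_norm _))) hl₂.le (norm_nonneg _)
  refine hs.schur_test (t := fun y => √((m₁ y).im * (m₂ y).im)) (c := √(l₁ * l₂))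
    ((BddMeas.of hm₁).im.mul (BddMeas.of hm₂).im).sqrt
    (((BddMeas.of hm₁).norm.mul (BddMeas.of hm₂).norm).inv (mul_pos hl₁ hl₂) norm_low) hw
    (Real.sqrt_pos.2 (by positivity)) (fun x => Real.sqrt_le_sqrt
      (mul_le_mul (low₁ x) (low₂ x) hl₂.le (hm₁.mem x).le)) fun x => ?_
  have hp : 0 < ‖m₁ x‖ * ‖m₂ x‖ := (mul_pos hl₁ hl₂).trans_le (norm_low x)
  rw [inv_mul_eq_div, le_div_iff₀ hp, mul_comm]
  refine le_trans ?_ (IsStep.le_sqrt_im hs hm₁ hm₂ h₁ h₂ x)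
  exact mul_le_mul_of_nonneg_left (le_add_of_nonneg_left (Real.sqrt_nonneg _)) hp.le

/-- If the kernel `s` dominates the kernel of `R²`, where `R` is the operator with kernel `r`, then
integrals against `s` dominate the corresponding averages over pairs of neighbours of a common
point `u`. -/
lemma integral_neighbours_le (hs : IsKernel s) (hr : IsKernel r)
    (hrs : ∀ x y, ∫ u, r x u * r u y ∂π ≤ s x y) {D : X → X → ℝ}
    (hD : BddMeas (fun p : X × X => D p.1 p.2)) (hD0 : ∀ x y, 0 ≤ D x y) :
    ∫ u, ∫ x, ∫ y, r u x * r u y * D x y ∂π ∂π ∂π ≤ ∫ x, ∫ y, s x y * D x y ∂π ∂π := by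
  have hF : BddMeas (fun p : (X × X) × X => r p.1.2 p.1.1 * r p.1.2 p.2 * D p.1.1 p.2) := by
    refine (BddMeas.mul ?_ ?_).mul ?_
    · exact hr.bdd.comp (g := fun p : (X × X) × X => (p.1.2, p.1.1)) (by fun_prop)
    · exact hr.bdd.comp (g := fun p : (X × X) × X => (p.1.2, p.2)) (by fun_prop)
    · exact hD.comp (g := fun p : (X × X) × X => (p.1.1, p.2)) (by fun_prop)
  have hFi : BddMeas (fun p : X × X => ∫ y, r p.2 p.1 * r p.2 y * D p.1 y ∂π) :=
    BddMeas.integral (f := fun (p : X × X) y => r p.2 p.1 * r p.2 y * D p.1 y) hF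
  have e1 : ∫ u, ∫ x, ∫ y, r u x * r u y * D x y ∂π ∂π ∂π
      = ∫ x, ∫ u, ∫ y, r u x * r u y * D x y ∂π ∂π ∂π :=
    (BddMeas.integral_swap (f := fun x u => ∫ y, r u x * r u y * D x y ∂π) hFi).symm
  have e2 : ∀ x, ∫ u, ∫ y, r u x * r u y * D x y ∂π ∂π
      = ∫ y, (∫ u, r x u * r u y ∂π) * D x y ∂π := by
    intro x
    have hx : BddMeas (fun p : X × X => r p.1 x * r p.1 p.2 * D x p.2) :=
      hF.comp (g := fun p : X × X => ((x, p.1), p.2)) (by fun_prop)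
    rw [BddMeas.integral_swap (f := fun u y => r u x * r u y * D x y) hx]
    refine integral_congr_ae (ae_of_all _ fun y => ?_)
    simp only
    rw [integral_mul_const]
    simp only [hr.symm _ x]
  have hrr : BddMeas (fun p : X × X => ∫ u, r p.1 u * r u p.2 ∂π) := by
    refine BddMeas.integral (f := fun (p : X × X) u => r p.1 u * r u p.2) (BddMeas.mul ?_ ?_)
    · exact hr.bdd.comp (g := fun p : (X × X) × X => (p.1.1, p.2)) (by fun_prop)
    · exact hr.bdd.comp (g := fun p : (X × X) × X => (p.2, p.1.2)) (by fun_prop)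
  have hL : BddMeas (fun p : X × X => (∫ u, r p.1 u * r u p.2 ∂π) * D p.1 p.2) := hrr.mul hD
  have hR : BddMeas (fun p : X × X => s p.1 p.2 * D p.1 p.2) := hs.bdd.mul hD
  rw [e1, integral_congr_ae (ae_of_all _ e2)]
  refine integral_mono
    (BddMeas.integral (f := fun x y => (∫ u, r x u * r u y ∂π) * D x y) hL).integrable
    (BddMeas.integral (f := fun x y => s x y * D x y) hR).integrable fun x => ?_
  exact integral_mono (hL.comp measurable_prodMk_left).integrable
    (hR.comp measurable_prodMk_left).integrable
    fun y => mul_le_mul_of_nonneg_right (hrs x y) (hD0 x y)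

/-- The `L²`-norm of `R w` controls the `L¹`-norm of `w ≥ 0` when the row sums of `r` are bounded
below. -/
lemma sq_integral_le_integral_sq_realOp (hr : IsKernel r) {c : ℝ} (hc : 0 ≤ c)
    (hrc : ∀ x, c ≤ ∫ y, r x y ∂π) {w : X → ℝ} (hw : BddMeas w) (hw0 : ∀ x, 0 ≤ w x) :
    c ^ 2 * (∫ x, w x ∂π) ^ 2 ≤ π.real Set.univ * ∫ u, realOp π r w u ^ 2 ∂π := by
  have hrw : BddMeas (fun p : X × X => r p.1 p.2 * w p.2) := hr.bdd.mul (hw.comp measurable_snd)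
  have h1 : c * ∫ x, w x ∂π ≤ ∫ u, realOp π r w u ∂π := by
    have e : ∫ u, realOp π r w u ∂π = ∫ x, (∫ u, r x u ∂π) * w x ∂π := by
      simp only [realOp]
      rw [BddMeas.integral_swap (f := fun u x => r u x * w x) hrw]
      refine integral_congr_ae (ae_of_all _ fun x => ?_)
      simp only
      rw [integral_mul_const]
      simp only [hr.symm _ x]
    rw [e, ← integral_const_mul]
    exact integral_mono (hw.integrable.const_mul c)
      ((BddMeas.integral hr.bdd).mul hw).integrable
      fun x => mul_le_mul_of_nonneg_right (hrc x) (hw0 x)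
  have h2 := sq_integral_le (μ := π) (hr.realOp_bdd (π := π) hw)
  have h3 : 0 ≤ ∫ x, w x ∂π := integral_nonneg hw0
  calc c ^ 2 * (∫ x, w x ∂π) ^ 2 = (c * ∫ x, w x ∂π) ^ 2 := by ring
    _ ≤ (∫ u, realOp π r w u ∂π) ^ 2 := pow_le_pow_left₀ (by positivity) h1 2
    _ ≤ _ := h2

/-- Diagonal positivity bounds the solution in `L²`, uniformly in the spectral parameter. -/
lemma IsStep.integral_sq_norm_le (ha : BddMeas a) (hs : IsKernel s) (hr : IsKernel r)
    (hrs : ∀ x y, ∫ u, r x u * r u y ∂π ≤ s x y) {c : ℝ} (hc : 0 < c)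
    (hrc : ∀ x, c ≤ ∫ y, r x y ∂π) {z : ℍ} {m : X → ℂ}
    (hm : IsBoundedMeasurable {w : ℂ | 0 < w.im} m) (h : IsStep π a s z m m) :
    ∫ x, ‖m x‖ ^ 2 ∂π ≤ π.real Set.univ / c ^ 2 := by
  have hw : BddMeas (fun x => ‖m x‖ ^ 2) := (BddMeas.of hm).norm.pow
  have hw0 : ∀ x, 0 ≤ ‖m x‖ ^ 2 := fun x => sq_nonneg _
  have h1 := sq_integral_le_integral_sq_realOp (π := π) hr hc.le hrc hw hw0
  have h2 : ∫ u, realOp π r (fun x => ‖m x‖ ^ 2) u ^ 2 ∂π ≤ ∫ x, ‖m x‖ ^ 2 ∂π := by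
    have hD : BddMeas (fun p : X × X => ‖m p.1‖ ^ 2 * ‖m p.2‖ ^ 2) :=
      (hw.comp measurable_fst).mul (hw.comp measurable_snd)
    have h3 := integral_neighbours_le (D := fun x y => ‖m x‖ ^ 2 * ‖m y‖ ^ 2) hs hr hrs hD
      fun x y => by positivity
    have h4 := h.integral_kernel_le ha hs hm hm h hw
    have e1 : ∀ u, ∫ x, ∫ y, r u x * r u y * (‖m x‖ ^ 2 * ‖m y‖ ^ 2) ∂π ∂π
        = realOp π r (fun x => ‖m x‖ ^ 2) u ^ 2 := by
      intro u
      rw [sq, realOp, ← integral_mul_const]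
      refine integral_congr_ae (ae_of_all _ fun x => ?_)
      simp only
      rw [← integral_const_mul]
      exact integral_congr_ae (ae_of_all _ fun y => by ring)
    have e2 : ∀ x, (‖m x‖ * ‖m x‖)⁻¹ * (‖m x‖ ^ 2) ^ 2 = ‖m x‖ ^ 2 := by
      intro x
      have : ‖m x‖ ≠ 0 := norm_ne_zero_iff.2 (h.ne_zero hs hm x)
      field_simp
    simp only [e1] at h3
    simp only [e2] at h4
    exact h3.trans h4
  have h5 : 0 ≤ ∫ x, ‖m x‖ ^ 2 ∂π := integral_nonneg hw0
  rw [le_div_iff₀ (by positivity)]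
  rcases h5.eq_or_lt with h6 | h6
  · rw [← h6, zero_mul]
    exact measureReal_nonneg
  · refine le_of_mul_le_mul_right ?_ h6
    have h7 := mul_le_mul_of_nonneg_left h2 (measureReal_nonneg (μ := π) (s := Set.univ))
    nlinarith

/-- Component regularity upgrades the `L²`-bound to a bound that is uniform in `x` and `z`: if
`|m_x|` is large, then so is `|m_y|` for many `y`. -/
theorem exists_norm_solution_le (ha : BddMeas a) (hs : IsKernel s) (hA : DiagonalPositivity π s)
    (hC : ComponentRegularity π a s) {m : ℍ → X → ℂ} (hm : IsSolution π a s m) :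
    ∃ C : ℝ, 0 < C ∧ ∀ z x, ‖m z x‖ ≤ C := by
  obtain ⟨r, hr, hrs, c, hc, hrc⟩ := hA
  set Λ := π.real Set.univ / c ^ 2
  have hΛ : 0 ≤ Λ := by positivity
  set C₀ := 3 * max 1 Λ
  have hC₀ : 0 < C₀ := by positivity
  have hC₀1 : 3 ≤ C₀ := by
    have := le_max_left 1 Λ
    simp only [C₀]
    linarith
  have hC₀Λ : 3 * Λ ≤ C₀ := by
    have := le_max_right 1 Λ
    simp only [C₀]
    linarith
  obtain ⟨ε₀, hε₀, hε⟩ := (mem_nhdsGT_iff_exists_Ioo_subset).1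
    (hC.eventually_gt_atTop (C₀ * Λ))
  rw [Set.mem_Ioi] at hε₀
  refine ⟨√(2 / ε₀), by positivity, fun z x => Real.le_sqrt_of_sq_le ?_⟩
  by_contra! hbig
  have hmz := hm.bddMeas z
  have hst := hm.isStep z
  have hne : ∀ y, 0 < ‖m z y‖ := fun y => norm_pos_iff.2 (hst.ne_zero hs hmz y)
  set ε := (‖m z x‖ ^ 2)⁻¹ with hεdef
  have hεpos : 0 < ε := by
    have := hne x
    positivity
  have hεlt : ε < ε₀ := by
    have h1 : ε < (2 / ε₀)⁻¹ := inv_strictAnti₀ (by positivity) hbig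
    rw [inv_div] at h1
    linarith
  have hinf : C₀ * Λ < ⨅ x : X, ∫ y, 1 / (ε + (a x - a y) ^ 2 + ∫ u, (s x u - s y u) ^ 2 ∂π) ∂π :=
    hε ⟨hεpos, hεlt⟩
  have hdist0 : ∀ x y, 0 ≤ ∫ u, (s x u - s y u) ^ 2 ∂π := fun x y =>
    integral_nonneg fun u => sq_nonneg _
  have hbdd : BddBelow (Set.range fun x : X =>
      ∫ y, 1 / (ε + (a x - a y) ^ 2 + ∫ u, (s x u - s y u) ^ 2 ∂π) ∂π) := by
    refine ⟨0, ?_⟩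
    rintro _ ⟨x, rfl⟩
    refine integral_nonneg fun y => ?_
    have := hdist0 x y
    positivity
  have hx := hinf.trans_le (ciInf_le hbdd x)
  -- the defining equation bounds the variation of `1 / m` by that of `a` and of the rows of `s`
  have comp : ∀ y, 1 / (ε + (a x - a y) ^ 2 + ∫ u, (s x u - s y u) ^ 2 ∂π)
      ≤ C₀ * ‖m z y‖ ^ 2 := by
    intro y
    have hL2 := hst.integral_sq_norm_le ha hs hr hrs hc hrc hmz
    have hd : ‖intOp π s (m z) x - intOp π s (m z) y‖ ^ 2
        ≤ (∫ u, (s x u - s y u) ^ 2 ∂π) * Λ := by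
      have hsd : BddMeas (fun u => s x u - s y u) := (hs.row x).sub (hs.row y)
      have e : intOp π s (m z) x - intOp π s (m z) y
          = ∫ u, ((s x u - s y u : ℝ) : ℂ) * m z u ∂π := by
        rw [intOp, intOp, ← integral_sub ((hs.row x).ofReal.mul (.of hmz)).integrable
          ((hs.row y).ofReal.mul (.of hmz)).integrable]
        simp [sub_mul]
      have h1 : ‖∫ u, ((s x u - s y u : ℝ) : ℂ) * m z u ∂π‖
          ≤ ∫ u, ‖s x u - s y u‖ * ‖m z u‖ ∂π := by
        refine (norm_integral_le_integral_norm _).trans (le_of_eq ?_)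
        simp only [norm_mul, Complex.norm_real]
      rw [e]
      refine (pow_le_pow_left₀ (norm_nonneg _) h1 2).trans ?_
      refine (sq_integral_mul_le hsd.norm (BddMeas.of hmz).norm).trans ?_
      simp only [Real.norm_eq_abs, sq_abs]
      exact mul_le_mul_of_nonneg_left hL2 (hdist0 x y)
    have e2 : -(1 / m z y) = -(1 / m z x) + ((a y - a x : ℝ) : ℂ)
        - (intOp π s (m z) x - intOp π s (m z) y) := by
      rw [hst x, hst y]
      push_cast
      ring
    have h3 : ‖m z y‖⁻¹ ≤ ‖m z x‖⁻¹ + |a x - a y|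
        + ‖intOp π s (m z) x - intOp π s (m z) y‖ := by
      have e3 : ‖m z y‖⁻¹ = ‖-(1 / m z y)‖ := by simp
      rw [e3, e2]
      refine (norm_sub_le _ _).trans (add_le_add_left ((norm_add_le _ _).trans (le_of_eq ?_)) _)
      rw [Complex.norm_real, Real.norm_eq_abs, abs_sub_comm]
      simp
    have h4 : (‖m z y‖ ^ 2)⁻¹
        ≤ C₀ * (ε + (a x - a y) ^ 2 + ∫ u, (s x u - s y u) ^ 2 ∂π) := by
      set A := ‖m z x‖⁻¹
      set B := |a x - a y|
      set D := ‖intOp π s (m z) x - intOp π s (m z) y‖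
      have hεA : ε = A ^ 2 := by simp only [hεdef, A, inv_pow]
      have hB : (a x - a y) ^ 2 = B ^ 2 := (sq_abs _).symm
      have h5 : (‖m z y‖ ^ 2)⁻¹ ≤ (A + B + D) ^ 2 := by
        rw [← inv_pow]
        exact pow_le_pow_left₀ (inv_nonneg.2 (norm_nonneg _)) h3 2
      have h6 : (A + B + D) ^ 2 ≤ 3 * (A ^ 2 + B ^ 2 + D ^ 2) := by
        nlinarith [sq_nonneg (A - B), sq_nonneg (B - D), sq_nonneg (A - D)]
      have h7 := hdist0 x y
      rw [hεA, hB]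
      set E := ∫ u, (s x u - s y u) ^ 2 ∂π
      have h8 := mul_le_mul_of_nonneg_right hC₀Λ h7
      have h9 := mul_le_mul_of_nonneg_right hC₀1 (add_nonneg (sq_nonneg A) (sq_nonneg B))
      nlinarith
    have hy := hne y
    have hpos : 0 < ε + (a x - a y) ^ 2 + ∫ u, (s x u - s y u) ^ 2 ∂π := by
      have := hdist0 x y
      positivity
    rw [div_le_iff₀ hpos]
    rw [inv_le_iff_one_le_mul₀ (by positivity)] at h4
    linarith
  have hLi : BddMeas (fun y => 1 / (ε + (a x - a y) ^ 2 + ∫ u, (s x u - s y u) ^ 2 ∂π)) := by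
    have hker : BddMeas (fun y => ∫ u, (s x u - s y u) ^ 2 ∂π) := by
      refine BddMeas.integral (f := fun y u => (s x u - s y u) ^ 2)
        (BddMeas.pow (BddMeas.sub ?_ hs.bdd))
      exact (hs.row x).comp measurable_snd
    have := (((BddMeas.const ε).add ((BddMeas.const (a x)).sub ha).pow).add hker).inv hεpos
      fun y => by
        have := hdist0 x y
        have := sq_nonneg (a x - a y)
        linarith
    simpa only [one_div] using this
  have hfin := integral_mono (μ := π) hLi.integrable
    ((BddMeas.of hmz).norm.pow.integrable.const_mul C₀) comp
  rw [integral_const_mul] at hfin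
  have := mul_le_mul_of_nonneg_left (hst.integral_sq_norm_le ha hs hr hrs hc hrc hmz) hC₀.le
  linarith

end QVE

/-! ### Stability of the equation -/

namespace QVE

/-- If `w` is aligned with `V`, and `e w̄` is aligned with `V̄`, then the phase `e` is close to `1`;
alignment is measured by the defects in `Re (w V̄) ≤ |w| L` and `Re (e w̄ V) ≤ |w| L`. -/
lemma sq_norm_one_sub_mul_le {e w V : ℂ} {L : ℝ} (he : ‖e‖ = 1) (hV : ‖V‖ ≤ L) :
    ‖1 - e‖ ^ 2 * (‖w‖ * L) ≤ 4 * ((L * ‖w‖ - ((starRingEnd ℂ) V * w).re)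
      + (L * ‖w‖ - (V * (e * (starRingEnd ℂ) w)).re)) := by
  have hL : 0 ≤ L := (norm_nonneg V).trans hV
  rcases hL.eq_or_lt with hL0 | hL0
  · have : V = 0 := norm_le_zero_iff.1 (hV.trans hL0.ge)
    simp [this, ← hL0]
  rcases (norm_nonneg w).eq_or_lt with hW0 | hW0
  · have : w = 0 := norm_le_zero_iff.1 hW0.ge
    simp [this]
  set W := ‖w‖ with hW
  set p := (starRingEnd ℂ) w
  have hp : ‖p‖ = W := by simp [p, W]
  -- both `w̄` and `e w̄` are close to the direction of `V̄`
  have near (f : ℂ) (hf : ‖f‖ = W) : ‖(L : ℂ) * f - (W : ℂ) * (starRingEnd ℂ) V‖ ^ 2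
      ≤ 2 * (L * W) * (L * W - (V * f).re) := by
    have e1 : ‖(L : ℂ) * f - (W : ℂ) * (starRingEnd ℂ) V‖ ^ 2
        = L ^ 2 * ‖f‖ ^ 2 - 2 * (L * W) * (V * f).re + W ^ 2 * ‖V‖ ^ 2 := by
      simp only [Complex.sq_norm, Complex.normSq_apply, Complex.sub_re, Complex.sub_im,
        Complex.mul_re, Complex.mul_im, Complex.ofReal_re, Complex.ofReal_im, Complex.conj_re,
        Complex.conj_im]
      ring
    have h2 : W ^ 2 * ‖V‖ ^ 2 ≤ W ^ 2 * L ^ 2 :=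
      mul_le_mul_of_nonneg_left (pow_le_pow_left₀ (norm_nonneg _) hV 2) (sq_nonneg _)
    rw [e1, hf]
    nlinarith
  have h1 := near p hp
  have h2 := near (e * p) (by rw [norm_mul, he, hp, one_mul])
  have hre : ((starRingEnd ℂ) V * w).re = (V * p).re := by
    simp only [p, Complex.mul_re, Complex.conj_re, Complex.conj_im]
    ring
  set x := ‖(L : ℂ) * p - (W : ℂ) * (starRingEnd ℂ) V‖
  set y := ‖(L : ℂ) * (e * p) - (W : ℂ) * (starRingEnd ℂ) V‖
  have h3 : L * W * ‖1 - e‖ ≤ x + y := by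
    have e2 : L * W * ‖1 - e‖ = ‖((L : ℂ) * p - (W : ℂ) * (starRingEnd ℂ) V)
        - ((L : ℂ) * (e * p) - (W : ℂ) * (starRingEnd ℂ) V)‖ := by
      rw [show ((L : ℂ) * p - (W : ℂ) * (starRingEnd ℂ) V)
        - ((L : ℂ) * (e * p) - (W : ℂ) * (starRingEnd ℂ) V) = L * p * (1 - e) by ring,
        norm_mul, norm_mul, hp, Complex.norm_real, Real.norm_of_nonneg hL]
    rw [e2]
    exact norm_sub_le _ _
  have hLW : 0 < L * W := mul_pos hL0 hW0
  have h4 : (L * W * ‖1 - e‖) ^ 2 ≤ 2 * (x ^ 2 + y ^ 2) := by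
    have := pow_le_pow_left₀ (by positivity) h3 2
    nlinarith [sq_nonneg (x - y)]
  rw [hre]
  refine le_of_mul_le_mul_left ?_ hLW
  calc L * W * (‖1 - e‖ ^ 2 * (W * L)) = (L * W * ‖1 - e‖) ^ 2 := by ring
    _ ≤ _ := h4
    _ ≤ _ := by linarith

/-- The total phase of two points of the upper half-plane stays away from `1` by the sum of
the sines of their arguments. -/
lemma le_norm_one_sub_phase {m₁ m₂ : ℂ} (h₁ : 0 < m₁.im) (h₂ : 0 < m₂.im) {Φ : ℝ}
    (b₁ : ‖m₁‖ ≤ Φ) (b₂ : ‖m₂‖ ≤ Φ) :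
    (m₁.im + m₂.im) / Φ ≤ ‖1 - m₁ * m₂ * (((‖m₁‖ * ‖m₂‖)⁻¹ : ℝ) : ℂ)‖ := by
  have n₁ : 0 < ‖m₁‖ := norm_pos_iff.2 fun h => by simp [h] at h₁
  have n₂ : 0 < ‖m₂‖ := norm_pos_iff.2 fun h => by simp [h] at h₂
  set e₁ : ℂ := m₁ * ((‖m₁‖⁻¹ : ℝ) : ℂ)
  set e₂ : ℂ := m₂ * ((‖m₂‖⁻¹ : ℝ) : ℂ)
  have he : m₁ * m₂ * (((‖m₁‖ * ‖m₂‖)⁻¹ : ℝ) : ℂ) = e₁ * e₂ := by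
    simp only [e₁, e₂, mul_inv, Complex.ofReal_mul]
    ring
  have hn : ‖e₁‖ = 1 := by
    simp only [e₁, norm_mul, Complex.norm_real, norm_inv, norm_norm]
    exact mul_inv_cancel₀ n₁.ne'
  have hconj : (starRingEnd ℂ) e₁ * e₁ = 1 := by
    rw [mul_comm, Complex.mul_conj, Complex.normSq_eq_norm_sq, hn]
    simp
  have hre : ‖1 - e₁ * e₂‖ = ‖(starRingEnd ℂ) e₁ - e₂‖ := by
    have : (starRingEnd ℂ) e₁ * (1 - e₁ * e₂) = (starRingEnd ℂ) e₁ - e₂ := by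
      rw [mul_sub, ← mul_assoc, hconj]
      ring
    rw [← this, norm_mul, Complex.norm_conj, hn, one_mul]
  rw [he, hre]
  have h3 : e₁.im + e₂.im ≤ ‖(starRingEnd ℂ) e₁ - e₂‖ := by
    refine le_trans ?_ (Complex.abs_im_le_norm _)
    rw [Complex.sub_im, Complex.conj_im]
    refine le_trans (le_of_eq ?_) (neg_le_abs _)
    ring
  refine le_trans ?_ h3
  have i₁ : e₁.im = m₁.im / ‖m₁‖ := by
    rw [div_eq_mul_inv, ← Complex.im_mul_ofReal]
  have i₂ : e₂.im = m₂.im / ‖m₂‖ := by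
    rw [div_eq_mul_inv, ← Complex.im_mul_ofReal]
  rw [i₁, i₂, add_div]
  exact add_le_add (div_le_div_of_nonneg_left h₁.le n₁ b₁)
    (div_le_div_of_nonneg_left h₂.le n₂ b₂)

variable {X : Type*} [MeasurableSpace X] {π : Measure X} [IsFiniteMeasure π] {a : X → ℝ}
  {s r : X → X → ℝ}

lemma integral_mul_sub_re {κ W : X → ℝ} {w : X → ℂ} (hκ : BddMeas κ) (hW : BddMeas W)
    (hw : BddMeas w) (α : ℝ) (f : ℂ) :
    ∫ y, κ y * (α * W y - (f * w y).re) ∂π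
      = α * ∫ y, κ y * W y ∂π - (f * ∫ y, (κ y : ℂ) * w y ∂π).re := by
  have hi : Integrable (fun y => f * ((κ y : ℂ) * w y)) π :=
    (hκ.ofReal.mul hw).integrable.const_mul f
  have hre : Integrable (fun y => (f * ((κ y : ℂ) * w y)).re) π := hi.re
  have h1 := integral_re hi
  simp only [RCLike.re_to_complex] at h1
  rw [← integral_const_mul, ← integral_const_mul, ← h1,
    ← integral_sub ((hκ.mul hW).integrable.const_mul α) hre]
  refine integral_congr_ae (ae_of_all _ fun y => ?_)
  simp only [Complex.mul_re, Complex.mul_im, Complex.ofReal_re,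
    Complex.ofReal_im]
  ring

/-- Around a single point with neighbourhood weights `κ`: the pairwise defects of `w` with respect
to the phase `e` control `‖w‖`, as soon as `e` stays away from `1`. The two alignments used are
that of the `w_x` with each other, and that of the `w_x` with the conjugates of the `e_x w̄_x`. -/
lemma sq_integral_le_defect {κ : X → ℝ} {w e : X → ℂ} (hκ : BddMeas κ) (hκ0 : ∀ x, 0 ≤ κ x)
    (hw : BddMeas w) (hem : BddMeas e) (he : ∀ x, ‖e x‖ = 1) {γ : ℝ} (hγ0 : 0 ≤ γ)
    (hγ : ∀ x, γ ≤ ‖1 - e x‖) :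
    γ ^ 2 * (∫ x, κ x * ‖w x‖ ∂π) ^ 2 ≤ 12 * ∫ x, ∫ y, κ x * κ y *
      (‖w x‖ * ‖w y‖ - (e x * (starRingEnd ℂ) (w x) * w y).re) ∂π ∂π := by
  set f : X → ℂ := fun x => e x * (starRingEnd ℂ) (w x)
  have hf : BddMeas f := hem.mul hw.star
  have hfn : ∀ x, ‖f x‖ = ‖w x‖ := fun x => by simp [f, he]
  set L := ∫ x, κ x * ‖w x‖ ∂π
  set V := ∫ x, (κ x : ℂ) * w x ∂π
  set F := ∫ x, (κ x : ℂ) * f x ∂π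
  have hnorm : ∀ g : X → ℂ, (∀ x, ‖g x‖ = ‖w x‖) → ‖∫ x, (κ x : ℂ) * g x ∂π‖ ≤ L := by
    intro g hg
    refine (norm_integral_le_integral_norm _).trans (le_of_eq ?_)
    refine integral_congr_ae (ae_of_all _ fun x => ?_)
    simp only [norm_mul, Complex.norm_real, Real.norm_of_nonneg (hκ0 x), hg x]
  have hV : ‖V‖ ≤ L := hnorm w fun _ => rfl
  have hF : ‖F‖ ≤ L := hnorm f hfn
  have hL : 0 ≤ L := (norm_nonneg V).trans hV
  have hd : ∫ x, ∫ y, κ x * κ y * (‖w x‖ * ‖w y‖ - (f x * w y).re) ∂π ∂π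
      = L * L - (V * F).re := by
    have e1 : ∀ x, ∫ y, κ x * κ y * (‖w x‖ * ‖w y‖ - (f x * w y).re) ∂π
        = κ x * (L * ‖w x‖ - (V * f x).re) := by
      intro x
      simp only [mul_assoc (κ x)]
      rw [integral_const_mul, integral_mul_sub_re hκ hw.norm hw, mul_comm L, mul_comm V]
    simp only [e1]
    rw [integral_mul_sub_re hκ hw.norm hf]
  have h1 : γ ^ 2 * (L * L) ≤ 4 * ((L * L - ((starRingEnd ℂ) V * V).re)
      + (L * L - (V * F).re)) := by
    have i1 : BddMeas (fun x => κ x * (L * ‖w x‖ - ((starRingEnd ℂ) V * w x).re)) :=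
      hκ.mul (((BddMeas.const _).mul hw.norm).sub ((BddMeas.const _).mul hw).re)
    have i2 : BddMeas (fun x => κ x * (L * ‖w x‖ - (V * f x).re)) :=
      hκ.mul (((BddMeas.const _).mul hw.norm).sub ((BddMeas.const _).mul hf).re)
    have e2 : γ ^ 2 * (L * L) = ∫ x, γ ^ 2 * L * (κ x * ‖w x‖) ∂π := by
      rw [integral_const_mul]
      ring
    rw [e2, ← integral_mul_sub_re hκ hw.norm hw L,
      ← integral_mul_sub_re hκ hw.norm hf L,
      ← integral_add i1.integrable i2.integrable, ← integral_const_mul (4 : ℝ)]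
    refine integral_mono ((hκ.mul hw.norm).integrable.const_mul _)
      (((i1.add i2).integrable (μ := π)).const_mul 4) fun x => ?_
    simp only
    have h2 := sq_norm_one_sub_mul_le (w := w x) (he x) hV
    have h3 : γ ^ 2 * (‖w x‖ * L) ≤ ‖1 - e x‖ ^ 2 * (‖w x‖ * L) :=
      mul_le_mul_of_nonneg_right (pow_le_pow_left₀ hγ0 (hγ x) 2) (by positivity)
    have h4 := mul_le_mul_of_nonneg_left (h3.trans h2) (hκ0 x)
    simp only [f]
    linarith
  have hVV : ((starRingEnd ℂ) V * V).re = ‖V‖ ^ 2 := by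
    rw [mul_comm, Complex.mul_conj, Complex.normSq_eq_norm_sq, Complex.ofReal_re]
  -- `|V| |F| ≥ L² - d` and `|F| ≤ L` force `|V|² ≥ L² - 2 d`
  have hVlow : L ^ 2 - 2 * (L * L - (V * F).re) ≤ ‖V‖ ^ 2 := by
    rcases hL.eq_or_lt with h0 | h0
    · have : V = 0 := norm_le_zero_iff.1 (hV.trans h0.ge)
      simp [this, ← h0]
    · have h5 : |(V * F).re| ≤ ‖V‖ * L := (Complex.abs_re_le_norm _).trans (by
        rw [norm_mul]
        exact mul_le_mul_of_nonneg_left hF (norm_nonneg _))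
      have h6 : (V * F).re ^ 2 ≤ ‖V‖ ^ 2 * L ^ 2 := by
        rw [← mul_pow, ← sq_abs]
        exact pow_le_pow_left₀ (abs_nonneg _) h5 2
      refine le_of_mul_le_mul_right ?_ (pow_pos h0 2)
      nlinarith [sq_nonneg (L * L - (V * F).re)]
  rw [hd]
  rw [hVV] at h1
  nlinarith

/-- Stability in `L¹`: two solutions whose total phases stay away from `1` by `γ` differ by at most
`O(γ⁻² |z₁ - z₂|)`. -/
lemma IsStep.integral_norm_sub_le (ha : BddMeas a) (hs : IsKernel s) (hr : IsKernel r)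
    (hrs : ∀ x y, ∫ u, r x u * r u y ∂π ≤ s x y) {c : ℝ} (hc : 0 < c)
    (hrc : ∀ x, c ≤ ∫ y, r x y ∂π) {z₁ z₂ : ℍ} {m₁ m₂ : X → ℂ}
    (hm₁ : IsBoundedMeasurable {w : ℂ | 0 < w.im} m₁)
    (hm₂ : IsBoundedMeasurable {w : ℂ | 0 < w.im} m₂)
    (h₁ : IsStep π a s z₁ m₁ m₁) (h₂ : IsStep π a s z₂ m₂ m₂) {γ : ℝ} (hγ0 : 0 ≤ γ)
    (hγ : ∀ x, γ ≤ ‖1 - m₁ x * m₂ x * (((‖m₁ x‖ * ‖m₂ x‖)⁻¹ : ℝ) : ℂ)‖) :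
    γ ^ 2 * c ^ 2 * ∫ x, ‖m₁ x - m₂ x‖ ∂π
      ≤ 12 * π.real Set.univ * ‖(z₁ : ℂ) - z₂‖ := by
  set w : X → ℂ := fun x => m₁ x - m₂ x
  have hw : BddMeas w := (BddMeas.of hm₁).sub (.of hm₂)
  set e : X → ℂ := fun x => m₁ x * m₂ x * (((‖m₁ x‖ * ‖m₂ x‖)⁻¹ : ℝ) : ℂ)
  have n₁ : ∀ x, 0 < ‖m₁ x‖ := fun x => norm_pos_iff.2 (h₁.ne_zero hs hm₁ x)
  have n₂ : ∀ x, 0 < ‖m₂ x‖ := fun x => norm_pos_iff.2 (h₂.ne_zero hs hm₂ x)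
  have he : ∀ x, ‖e x‖ = 1 := by
    intro x
    have := n₁ x
    have := n₂ x
    simp only [e, norm_mul, Complex.norm_real, norm_inv, norm_norm]
    field_simp
  have hem : BddMeas e := by
    refine .mk' (C := 1) ?_ fun x => (he x).le
    exact (hm₁.measurable.mul hm₂.measurable).mul
      (Complex.measurable_ofReal.comp (hm₁.measurable.norm.mul hm₂.measurable.norm).inv)
  set D : X → X → ℝ := fun x y => ‖w x‖ * ‖w y‖ - (e x * (starRingEnd ℂ) (w x) * w y).re
  have hD : BddMeas (fun p : X × X => D p.1 p.2) :=
    ((hw.norm.comp measurable_fst).mul (hw.norm.comp measurable_snd)).sub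
      (((hem.mul hw.star).comp measurable_fst).mul (hw.comp measurable_snd)).re
  have hD0 : ∀ x y, 0 ≤ D x y := by
    intro x y
    have := (le_abs_self _).trans (Complex.abs_re_le_norm (e x * (starRingEnd ℂ) (w x) * w y))
    rw [norm_mul, norm_mul, he, Complex.norm_conj, one_mul] at this
    simp only [D]
    linarith
  set δ := ‖(z₁ : ℂ) - z₂‖
  -- the equation for `w`, tested against `w̄ / |m₁ m₂|`
  have hsD : ∫ x, ∫ y, s x y * D x y ∂π ∂π ≤ δ * ∫ x, ‖w x‖ ∂π := by
    set f : X → ℂ := fun x => e x * (starRingEnd ℂ) (w x)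
    have hf : BddMeas f := hem.mul hw.star
    have hfS : BddMeas (fun x => (f x * intOp π s w x).re) := (hf.mul (hs.intOp_bdd hw)).re
    have e1 : ∫ x, ∫ y, s x y * D x y ∂π ∂π
        = ∫ x, ∫ y, s x y * (‖w x‖ * ‖w y‖) ∂π ∂π - ∫ x, (f x * intOp π s w x).re ∂π := by
      have e2 : ∀ x, ∫ y, s x y * D x y ∂π
          = ‖w x‖ * realOp π s (fun y => ‖w y‖) x - (f x * intOp π s w x).re := fun x =>
        integral_mul_sub_re (hs.row x) hw.norm hw _ _
      have e3 : ∀ x, ∫ y, s x y * (‖w x‖ * ‖w y‖) ∂π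
          = ‖w x‖ * realOp π s (fun y => ‖w y‖) x := by
        intro x
        rw [realOp, ← integral_const_mul]
        exact integral_congr_ae (ae_of_all _ fun y => by ring)
      simp only [e2, e3]
      exact integral_sub (hw.norm.mul (hs.realOp_bdd hw.norm)).integrable hfS.integrable
    have hP : ∀ x, (‖m₁ x‖ * ‖m₂ x‖)⁻¹ * ‖w x‖ ^ 2
        = (f x * ((z₁ : ℂ) - z₂ + intOp π s w x)).re := by
      intro x
      have hx := IsStep.sub_eq hs hm₁ hm₂ h₁ h₂ x
      change w x = m₁ x * m₂ x * ((z₁ : ℂ) - z₂ + intOp π s w x) at hx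
      have : f x * ((z₁ : ℂ) - z₂ + intOp π s w x)
          = (((‖m₁ x‖ * ‖m₂ x‖)⁻¹ * ‖w x‖ ^ 2 : ℝ) : ℂ) := by
        calc f x * ((z₁ : ℂ) - z₂ + intOp π s w x)
            = (((‖m₁ x‖ * ‖m₂ x‖)⁻¹ : ℝ) : ℂ) * ((starRingEnd ℂ) (w x)
              * (m₁ x * m₂ x * ((z₁ : ℂ) - z₂ + intOp π s w x))) := by
              simp only [f, e]
              ring
          _ = _ := by
              rw [← hx, mul_comm ((starRingEnd ℂ) (w x)), Complex.mul_conj,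
                Complex.normSq_eq_norm_sq, ← Complex.ofReal_mul]
      rw [this, Complex.ofReal_re]
    have h3 := h₁.integral_kernel_le ha hs hm₁ hm₂ h₂ hw.norm
    simp only [hP] at h3
    rw [e1]
    have h4 : ∫ x, (f x * ((z₁ : ℂ) - z₂ + intOp π s w x)).re ∂π
        - ∫ x, (f x * intOp π s w x).re ∂π ≤ δ * ∫ x, ‖w x‖ ∂π := by
      rw [← integral_sub (hf.mul ((BddMeas.const _).add (hs.intOp_bdd hw))).re.integrable
        hfS.integrable, ← integral_const_mul]
      refine integral_mono ((hf.mul ((BddMeas.const _).add (hs.intOp_bdd hw))).re.sub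
        hfS).integrable (hw.norm.integrable.const_mul _) fun x => ?_
      simp only
      rw [← Complex.sub_re, mul_add, add_sub_cancel_right]
      refine (le_abs_self _).trans ((Complex.abs_re_le_norm _).trans (le_of_eq ?_))
      simp only [f, norm_mul, he, Complex.norm_conj, δ]
      ring
    linarith
  have hloc : ∀ u, γ ^ 2 * realOp π r (fun x => ‖w x‖) u ^ 2
      ≤ 12 * ∫ x, ∫ y, r u x * r u y * D x y ∂π ∂π := fun u =>
    sq_integral_le_defect (hr.row u) (hr.nonneg u) hw hem he hγ0 hγ
  have hrD : BddMeas (fun u => ∫ x, ∫ y, r u x * r u y * D x y ∂π ∂π) := by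
    refine BddMeas.integral (f := fun u x => ∫ y, r u x * r u y * D x y ∂π) ?_
    refine BddMeas.integral (f := fun (p : X × X) y => r p.1 p.2 * r p.1 y * D p.2 y)
      ((BddMeas.mul ?_ ?_).mul ?_)
    · exact hr.bdd.comp (g := fun p : (X × X) × X => p.1) (by fun_prop)
    · exact hr.bdd.comp (g := fun p : (X × X) × X => (p.1.1, p.2)) (by fun_prop)
    · exact hD.comp (g := fun p : (X × X) × X => (p.1.2, p.2)) (by fun_prop)
  have hglob : γ ^ 2 * ∫ u, realOp π r (fun x => ‖w x‖) u ^ 2 ∂π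
      ≤ 12 * ∫ u, ∫ x, ∫ y, r u x * r u y * D x y ∂π ∂π ∂π := by
    rw [← integral_const_mul, ← integral_const_mul]
    exact integral_mono ((hr.realOp_bdd hw.norm).pow.integrable.const_mul _)
      (hrD.integrable.const_mul _) hloc
  have hnb := integral_neighbours_le hs hr hrs hD hD0
  have hlow := sq_integral_le_integral_sq_realOp (π := π) hr hc.le hrc hw.norm
    fun x => norm_nonneg _
  set I := ∫ x, ‖w x‖ ∂π
  have hI : 0 ≤ I := integral_nonneg fun x => norm_nonneg _
  have hμ : 0 ≤ π.real Set.univ := measureReal_nonneg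
  rcases hI.eq_or_lt with h0 | h0
  · rw [← h0, mul_zero]
    positivity
  · refine le_of_mul_le_mul_right ?_ h0
    calc γ ^ 2 * c ^ 2 * I * I = γ ^ 2 * (c ^ 2 * I ^ 2) := by ring
      _ ≤ γ ^ 2 * (π.real Set.univ * ∫ u, realOp π r (fun x => ‖w x‖) u ^ 2 ∂π) :=
        mul_le_mul_of_nonneg_left hlow (sq_nonneg _)
      _ = π.real Set.univ * (γ ^ 2 * ∫ u, realOp π r (fun x => ‖w x‖) u ^ 2 ∂π) := by ring
      _ ≤ π.real Set.univ * (12 * (δ * I)) := by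
        refine mul_le_mul_of_nonneg_left (hglob.trans ?_) hμ
        linarith
      _ = 12 * π.real Set.univ * δ * I := by ring

end QVE

/-! ### Comparability of the imaginary parts -/

namespace QVE

variable {X : Type*} [MeasurableSpace X] {π : Measure X} {a : X → ℝ}
  {s r : X → X → ℝ}

lemma IsKernel.iterKernel_nonneg (hs : IsKernel s) (n : ℕ) (x y : X) :
    0 ≤ iterKernel π s n x y := by
  induction n generalizing x y with
  | zero => exact hs.nonneg x y
  | succ n ih => exact integral_nonneg fun u => mul_nonneg (ih x u) (hs.nonneg u y)

variable [IsFiniteMeasure π]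

lemma IsKernel.iterKernel_bdd (hs : IsKernel s) (n : ℕ) :
    BddMeas (fun p : X × X => iterKernel π s n p.1 p.2) := by
  induction n with
  | zero => exact hs.bdd
  | succ n ih =>
    refine BddMeas.integral (f := fun (p : X × X) u => iterKernel π s n p.1 u * s u p.2)
      (BddMeas.mul ?_ ?_)
    · exact ih.comp (g := fun p : (X × X) × X => (p.1.1, p.2)) (by fun_prop)
    · exact hs.bdd.comp (g := fun p : (X × X) × X => (p.2, p.1.2)) (by fun_prop)

/-- A positive supersolution of `κ S` is a supersolution of all iterates. -/
lemma IsKernel.iterKernel_le (hs : IsKernel s) {v : X → ℝ} (hv : BddMeas v) {κ : ℝ}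
    (hκ : 0 ≤ κ) (h : ∀ x, κ * realOp π s v x ≤ v x) (n : ℕ) (x : X) :
    κ ^ (n + 1) * ∫ y, iterKernel π s n x y * v y ∂π ≤ v x := by
  induction n with
  | zero =>
    rw [zero_add, pow_one]
    exact h x
  | succ n ih =>
    have hKx : BddMeas (iterKernel π s n x) :=
      (hs.iterKernel_bdd n).comp measurable_prodMk_left
    have e : ∫ y, iterKernel π s (n + 1) x y * v y ∂π
        = ∫ u, iterKernel π s n x u * realOp π s v u ∂π := by
      have hF : BddMeas (fun p : X × X => iterKernel π s n x p.2 * s p.2 p.1 * v p.1) := by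
        refine (BddMeas.mul ?_ ?_).mul (hv.comp measurable_fst)
        · exact hKx.comp measurable_snd
        · exact hs.bdd.comp measurable_swap
      simp only [iterKernel, realOp, ← integral_mul_const, ← integral_const_mul]
      rw [BddMeas.integral_swap (f := fun y u => iterKernel π s n x u * s u y * v y) hF]
      refine integral_congr_ae (ae_of_all _ fun u => ?_)
      exact integral_congr_ae (ae_of_all _ fun y => by ring)
    calc κ ^ (n + 1 + 1) * ∫ y, iterKernel π s (n + 1) x y * v y ∂π
        = κ ^ (n + 1) * ∫ u, iterKernel π s n x u * (κ * realOp π s v u) ∂π := by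
          rw [e, pow_succ, mul_assoc, ← integral_const_mul]
          congr 1
          exact integral_congr_ae (ae_of_all _ fun u => by ring)
      _ ≤ κ ^ (n + 1) * ∫ u, iterKernel π s n x u * v u ∂π := by
          refine mul_le_mul_of_nonneg_left (integral_mono
            (hKx.mul ((BddMeas.const κ).mul (hs.realOp_bdd hv))).integrable
            (hKx.mul hv).integrable fun u => ?_) (by positivity)
          exact mul_le_mul_of_nonneg_left (h u) (hs.iterKernel_nonneg n x u)
      _ ≤ v x := ih

/-- On bounded sets of spectral parameters, the imaginary parts of the components of the solution
are comparable to each other, by uniform primitivity. -/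
lemma exists_im_solution_le (ha : BddMeas a) (hs : IsKernel s) (hB : UniformPrimitivity π s)
    {m : ℍ → X → ℂ} (hm : IsSolution π a s m) {Φ : ℝ} (hΦ : 0 < Φ) (hmΦ : ∀ z x, ‖m z x‖ ≤ Φ)
    {R : ℝ} (hR : 0 ≤ R) :
    ∃ K : ℝ, 0 < K ∧ ∀ z : ℍ, ‖(z : ℂ)‖ ≤ R → ∀ x y, (m z y).im ≤ K * (m z x).im := by
  obtain ⟨A, hA0, hA⟩ := ha.exists_bound
  obtain ⟨C, hC0, hC⟩ := hs.exists_bound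
  obtain ⟨n, c, hc, hK⟩ := hB
  set κ := (R + A + C * (Φ * π.real Set.univ))⁻¹ ^ 2
  have hκ : 0 < κ := by positivity
  refine ⟨Φ ^ 2 * (κ⁻¹ + C * (κ ^ (n + 1) * c)⁻¹), by positivity, fun z hz x y => ?_⟩
  have hmz := hm.bddMeas z
  have hst := hm.isStep z
  have hzp := z.im_pos
  set v : X → ℝ := fun y => (m z y).im
  have hv : BddMeas v := (BddMeas.of hmz).im
  have hv0 : ∀ x, 0 ≤ v x := fun x => (hmz.mem x).le
  have hSv := hs.realOp_nonneg (π := π) hv0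
  have hlow : ∀ x, κ * (z.im + realOp π s v x) ≤ v x := by
    intro x
    have h1 := hst.im_eq hs hmz x
    have h2 := hst.le_norm hs hmz hA hC hC0.le (hmΦ z) x
    have h3 : (R + A + C * (Φ * π.real Set.univ))⁻¹ ≤ ‖m z x‖ :=
      (inv_anti₀ (by positivity) (by gcongr)).trans h2
    simp only [v] at h1 ⊢
    rw [h1]
    have := hSv x
    exact mul_le_mul_of_nonneg_right (pow_le_pow_left₀ (by positivity) h3 2) (by positivity)
  have hI0 : 0 ≤ ∫ y, v y ∂π := integral_nonneg hv0
  have h1 : z.im ≤ κ⁻¹ * v x := by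
    rw [inv_mul_eq_div, le_div_iff₀ hκ]
    have := hlow x
    have := mul_nonneg hκ.le (hSv x)
    linarith
  have h2 : ∫ y, v y ∂π ≤ (κ ^ (n + 1) * c)⁻¹ * v x := by
    rw [inv_mul_eq_div, le_div_iff₀ (by positivity)]
    have h3 := hs.iterKernel_le hv hκ.le (fun x => by
      have := hlow x
      have := mul_pos hκ hzp
      linarith) n x
    have h4 : c * ∫ y, v y ∂π ≤ ∫ y, iterKernel π s n x y * v y ∂π := by
      rw [← integral_const_mul]
      exact integral_mono (hv.integrable.const_mul c)
        (((hs.iterKernel_bdd n).comp measurable_prodMk_left).mul hv).integrable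
        fun y => mul_le_mul_of_nonneg_right (hK x y) (hv0 y)
    have h5 := mul_le_mul_of_nonneg_left h4 (pow_nonneg hκ.le (n + 1))
    linarith
  have h6 := hs.realOp_le_integral (π := π) hC hv hv0 y
  calc v y = ‖m z y‖ ^ 2 * (z.im + realOp π s v y) := hst.im_eq hs hmz y
    _ ≤ Φ ^ 2 * (κ⁻¹ * v x + C * ((κ ^ (n + 1) * c)⁻¹ * v x)) := by
      have := hSv y
      refine mul_le_mul (pow_le_pow_left₀ (norm_nonneg _) (hmΦ z y) 2) (add_le_add h1
        (h6.trans (mul_le_mul_of_nonneg_left h2 hC0.le))) (by positivity) (by positivity)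
    _ = _ := by ring

/-! ### Hölder continuity -/

/-- Far from the origin the solution is so small that the equation is stable for trivial
reasons. -/
lemma exists_integral_norm_sub_le_of_large (ha : BddMeas a) (hs : IsKernel s)
    {m : ℍ → X → ℂ} (hm : IsSolution π a s m) {Φ : ℝ} (hΦ : 0 < Φ) (hmΦ : ∀ z x, ‖m z x‖ ≤ Φ) :
    ∃ R : ℝ, 0 ≤ R ∧ ∀ z₁ z₂ : ℍ, R ≤ ‖(z₁ : ℂ)‖ → R ≤ ‖(z₂ : ℂ)‖ →
      ∫ x, ‖m z₁ x - m z₂ x‖ ∂π ≤ 2 * π.real Set.univ * ‖(z₁ : ℂ) - z₂‖ := by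
  obtain ⟨A, hA0, hA⟩ := ha.exists_bound
  obtain ⟨C, hC0, hC⟩ := hs.exists_bound
  have hμ : 0 ≤ π.real Set.univ := measureReal_nonneg
  set T := 1 + 2 * π.real Set.univ * C
  have hT1 : 1 ≤ T := le_add_of_nonneg_right (by positivity)
  have small : ∀ z : ℍ, A + C * (Φ * π.real Set.univ) + T ≤ ‖(z : ℂ)‖ → ∀ x, ‖m z x‖ * T ≤ 1 := by
    intro z hz x
    have h1 : T ≤ ‖m z x‖⁻¹ := by
      have e : ‖m z x‖⁻¹ = ‖-(1 / m z x)‖ := by simp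
      rw [e, hm.eqn z x, add_assoc]
      have h2 := norm_sub_le_norm_add (z : ℂ) ((a x : ℂ) + intOp π s (m z) x)
      have h3 : ‖(a x : ℂ) + intOp π s (m z) x‖ ≤ A + C * (Φ * π.real Set.univ) := by
        refine (norm_add_le _ _).trans (add_le_add (by simpa using hA x) ?_)
        exact (hs.norm_intOp_le _ _).trans (hs.realOp_le_const hC hC0.le
          (BddMeas.of (hm.bddMeas z)).norm (fun _ => norm_nonneg _) (hmΦ z) x)
      linarith
    have h0 := norm_pos_iff.2 ((hm.isStep z).ne_zero hs (hm.bddMeas z) x)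
    calc ‖m z x‖ * T ≤ ‖m z x‖ * ‖m z x‖⁻¹ := mul_le_mul_of_nonneg_left h1 h0.le
      _ = 1 := mul_inv_cancel₀ h0.ne'
  refine ⟨A + C * (Φ * π.real Set.univ) + T, by positivity, fun z₁ z₂ hz₁ hz₂ => ?_⟩
  have hw : BddMeas (fun x => m z₁ x - m z₂ x) :=
    (BddMeas.of (hm.bddMeas z₁)).sub (.of (hm.bddMeas z₂))
  set δ := ‖(z₁ : ℂ) - z₂‖
  set I := ∫ x, ‖m z₁ x - m z₂ x‖ ∂π
  have hI : 0 ≤ I := integral_nonneg fun x => norm_nonneg _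
  have hpt : ∀ x, T * ‖m z₁ x - m z₂ x‖ ≤ δ + C * I := by
    intro x
    rw [IsStep.sub_eq hs (hm.bddMeas z₁) (hm.bddMeas z₂) (hm.isStep z₁) (hm.isStep z₂), norm_mul,
      norm_mul]
    have h1 := small z₁ hz₁ x
    have h2 : ‖m z₂ x‖ ≤ 1 := by
      have := small z₂ hz₂ x
      have := norm_nonneg (m z₂ x)
      nlinarith
    have h3 : ‖(z₁ : ℂ) - z₂ + intOp π s (fun y => m z₁ y - m z₂ y) x‖ ≤ δ + C * I :=
      (norm_add_le _ _).trans (add_le_add_right ((hs.norm_intOp_le _ _).trans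
        (hs.realOp_le_integral hC hw.norm (fun _ => norm_nonneg _) x)) _)
    calc T * (‖m z₁ x‖ * ‖m z₂ x‖ * ‖(z₁ : ℂ) - z₂ + intOp π s (fun y => m z₁ y - m z₂ y) x‖)
        = (‖m z₁ x‖ * T) * (‖m z₂ x‖
          * ‖(z₁ : ℂ) - z₂ + intOp π s (fun y => m z₁ y - m z₂ y) x‖) := by ring
      _ ≤ 1 * (1 * (δ + C * I)) := by gcongr
      _ = δ + C * I := by ring
  have h4 : T * I ≤ π.real Set.univ * (δ + C * I) := by
    rw [← integral_const_mul]
    calc ∫ x, T * ‖m z₁ x - m z₂ x‖ ∂π ≤ ∫ _, (δ + C * I) ∂π :=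
          integral_mono (hw.norm.integrable.const_mul T) (integrable_const _) hpt
      _ = _ := by simp
  simp only [T] at h4
  have := mul_nonneg hμ (mul_nonneg hC0.le hI)
  nlinarith [norm_nonneg ((z₁ : ℂ) - z₂)]

/-- Hölder continuity at the scale `g ^ 3` for spectral parameters at least as far from the real
line. If the imaginary part of the solution exceeds `g`, then the stability bound applies with
`γ ∼ g`; otherwise the Schwarz–Pick inequality bounds the difference by `g`. -/
lemma exists_norm_sub_le_of_scale (ha : BddMeas a) (hs : IsKernel s)
    (hA : DiagonalPositivity π s) (hB : UniformPrimitivity π s) {m : ℍ → X → ℂ}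
    (hm : IsSolution π a s m) {Φ : ℝ} (hΦ : 0 < Φ) (hmΦ : ∀ z x, ‖m z x‖ ≤ Φ) :
    ∃ C : ℝ, 0 < C ∧ ∀ (z₁ z₂ : ℍ) (g : ℝ), 0 < g → g ≤ 1 → ‖(z₁ : ℂ) - z₂‖ ≤ g ^ 3 →
      g ^ 3 ≤ z₁.im → g ^ 3 ≤ z₂.im → ∀ x, ‖m z₁ x - m z₂ x‖ ≤ C * g := by
  obtain ⟨C, hC0, hC⟩ := hs.exists_bound
  obtain ⟨R, hR0, hR⟩ := exists_integral_norm_sub_le_of_large ha hs hm hΦ hmΦ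
  obtain ⟨K, hK0, hK⟩ := exists_im_solution_le ha hs hB hm hΦ hmΦ (R := R + 2) (by positivity)
  obtain ⟨r, hr, hrs, c, hc, hrc⟩ := hA
  have hμ : 0 ≤ π.real Set.univ := measureReal_nonneg
  set J := 2 * π.real Set.univ + 12 * π.real Set.univ * (K * Φ) ^ 2 / c ^ 2
  have hJ2 : 2 * π.real Set.univ ≤ J := le_add_of_nonneg_right (by positivity)
  have hJ12 : 12 * π.real Set.univ * (K * Φ) ^ 2 / c ^ 2 ≤ J :=
    le_add_of_nonneg_left (by positivity)
  have hJ0 : 0 ≤ J := by positivity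
  refine ⟨1 + Φ ^ 2 * (1 + C * J), by positivity, fun z₁ z₂ g hg0 hg1 hz h₁ h₂ x => ?_⟩
  have b₁ := hm.bddMeas z₁
  have b₂ := hm.bddMeas z₂
  have st₁ := hm.isStep z₁
  have st₂ := hm.isStep z₂
  have hw : BddMeas (fun x => m z₁ x - m z₂ x) := (BddMeas.of b₁).sub (.of b₂)
  have hg3 : g ^ 3 ≤ g := by
    have : g ^ 2 ≤ 1 := pow_le_one₀ hg0.le hg1
    nlinarith
  have of_integral : ∫ x, ‖m z₁ x - m z₂ x‖ ∂π ≤ J * g →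
      ‖m z₁ x - m z₂ x‖ ≤ (1 + Φ ^ 2 * (1 + C * J)) * g := by
    intro hI
    rw [IsStep.sub_eq hs b₁ b₂ st₁ st₂, norm_mul, norm_mul]
    have h3 : ‖(z₁ : ℂ) - z₂ + intOp π s (fun y => m z₁ y - m z₂ y) x‖ ≤ g + C * (J * g) :=
      (norm_add_le _ _).trans (add_le_add (hz.trans hg3) ((hs.norm_intOp_le _ _).trans
        ((hs.realOp_le_integral hC hw.norm (fun _ => norm_nonneg _) x).trans
          (mul_le_mul_of_nonneg_left hI hC0.le))))
    calc ‖m z₁ x‖ * ‖m z₂ x‖ * ‖(z₁ : ℂ) - z₂ + intOp π s (fun y => m z₁ y - m z₂ y) x‖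
        ≤ Φ * Φ * (g + C * (J * g)) := by
          gcongr
          · exact hmΦ z₁ x
          · exact hmΦ z₂ x
      _ = Φ ^ 2 * (1 + C * J) * g := by ring
      _ ≤ _ := by nlinarith
  by_cases hbig : R + 1 < ‖(z₁ : ℂ)‖
  · apply of_integral
    have h3 : R ≤ ‖(z₂ : ℂ)‖ := by
      have := norm_sub_norm_le (z₁ : ℂ) z₂
      linarith
    refine (hR z₁ z₂ (by linarith) h3).trans ?_
    exact mul_le_mul hJ2 (hz.trans hg3) (norm_nonneg _) hJ0
  push Not at hbig
  have hbig2 : ‖(z₂ : ℂ)‖ ≤ R + 2 := by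
    have := norm_sub_norm_le (z₂ : ℂ) z₁
    rw [norm_sub_rev] at this
    linarith
  by_cases hlarge : ∃ y, g ≤ (m z₁ y).im + (m z₂ y).im
  · obtain ⟨y, hy⟩ := hlarge
    apply of_integral
    have hγ : ∀ x, g / (K * Φ) ≤ ‖1 - m z₁ x * m z₂ x * (((‖m z₁ x‖ * ‖m z₂ x‖)⁻¹ : ℝ) : ℂ)‖ := by
      intro x
      refine le_trans ?_ (le_norm_one_sub_phase (b₁.mem x) (b₂.mem x) (hmΦ z₁ x) (hmΦ z₂ x))
      rw [← div_div]
      refine div_le_div_of_nonneg_right ?_ hΦ.le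
      rw [div_le_iff₀ hK0]
      have := hK z₁ (by linarith) x y
      have := hK z₂ hbig2 x y
      linarith
    have h3 := st₁.integral_norm_sub_le ha hs hr hrs hc hrc b₁ b₂ st₂ (by positivity) hγ
    set I := ∫ x, ‖m z₁ x - m z₂ x‖ ∂π
    have h4 : (g / (K * Φ)) ^ 2 * c ^ 2 * I ≤ 12 * π.real Set.univ * g ^ 3 :=
      h3.trans (mul_le_mul_of_nonneg_left hz (by positivity))
    refine le_trans ?_ (mul_le_mul_of_nonneg_right hJ12 hg0.le)
    have hp : 0 < (g / (K * Φ)) ^ 2 * c ^ 2 := by positivity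
    refine le_of_mul_le_mul_left (h4.trans (le_of_eq ?_)) hp
    field_simp
  · push Not at hlarge
    have h3 := norm_sub_le_of_isStep ha hs b₁ b₂ st₁ st₂ x
    have p₁ : 0 < (m z₁ x).im := b₁.mem x
    have p₂ : 0 < (m z₂ x).im := b₂.mem x
    have h4 : √((m z₁ x).im * (m z₂ x).im) ≤ g := by
      rw [Real.sqrt_le_left hg0.le, sq]
      have := hlarge x
      exact mul_le_mul (by linarith) (by linarith) p₂.le hg0.le
    have h5 : ‖(z₁ : ℂ) - z₂‖ / √(z₁.im * z₂.im) ≤ 1 := by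
      refine div_le_one_of_le₀ (hz.trans (Real.le_sqrt_of_sq_le ?_)) (Real.sqrt_nonneg _)
      rw [sq]
      exact mul_le_mul h₁ h₂ (by positivity) z₁.im_pos.le
    calc ‖m z₁ x - m z₂ x‖ ≤ 1 * g :=
          h3.trans (mul_le_mul h5 h4 (Real.sqrt_nonneg _) zero_le_one)
      _ ≤ (1 + Φ ^ 2 * (1 + C * J)) * g :=
          mul_le_mul_of_nonneg_right (le_add_of_nonneg_right (by positivity)) hg0.le

/-- The vertical translate of a point of the closed upper half-plane by `h > 0`. -/
noncomputable def raise (w : ClosedUpperHalfPlane) {h : ℝ} (hh : 0 < h) : ℍ :=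
  ⟨(w : ℂ) + h * Complex.I, by simpa using add_pos_of_nonneg_of_pos w.2 hh⟩

lemma coe_raise (w : ClosedUpperHalfPlane) {h : ℝ} (hh : 0 < h) :
    (raise w hh : ℂ) = (w : ℂ) + h * Complex.I := rfl

lemma im_raise (w : ClosedUpperHalfPlane) {h : ℝ} (hh : 0 < h) :
    (raise w hh).im = (w : ℂ).im + h := by
  rw [← UpperHalfPlane.coe_im, coe_raise]
  simp

lemma coe_toClosed (z : ℍ) : ((toClosed z : ClosedUpperHalfPlane) : ℂ) = z := rfl

/-- Hölder continuity of the solution in the open half-plane, uniformly up to the real line. Points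
close to the real line are raised by repeatedly doubling their height; the increments form a
geometric sum. -/
theorem exists_holder_solution (ha : BddMeas a) (hs : IsKernel s)
    (hA : DiagonalPositivity π s) (hB : UniformPrimitivity π s) {m : ℍ → X → ℂ}
    (hm : IsSolution π a s m) {Φ : ℝ} (hΦ : 0 < Φ) (hmΦ : ∀ z x, ‖m z x‖ ≤ Φ) :
    ∃ C : ℝ, 0 < C ∧ ∀ (z₁ z₂ : ℍ) (x : X),
      ‖m z₁ x - m z₂ x‖ ≤ C * ‖(z₁ : ℂ) - z₂‖ ^ (1 / 3 : ℝ) := by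
  obtain ⟨C, hC0, hC⟩ := exists_norm_sub_le_of_scale ha hs hA hB hm hΦ hmΦ
  have scale : ∀ (z₁ z₂ : ℍ) (h : ℝ), 0 < h → h ≤ 1 → ‖(z₁ : ℂ) - z₂‖ ≤ h → h ≤ z₁.im →
      h ≤ z₂.im → ∀ x, ‖m z₁ x - m z₂ x‖ ≤ C * h ^ (1 / 3 : ℝ) := by
    intro z₁ z₂ h h0 h1 hz h₁ h₂
    have e : (h ^ (1 / 3 : ℝ)) ^ 3 = h := by
      rw [← Real.rpow_natCast, ← Real.rpow_mul h0.le]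
      norm_num
    exact hC z₁ z₂ (h ^ (1 / 3 : ℝ)) (by positivity) (Real.rpow_le_one h0.le h1 (by norm_num))
      (by rwa [e]) (by rwa [e]) (by rwa [e])
  -- `2 ^ (-1/3) ≤ 4/5` makes `4 C` a constant that reproduces itself in the induction
  have half : ∀ h : ℝ, 0 < h → (h / 2) ^ (1 / 3 : ℝ) ≤ 4 / 5 * h ^ (1 / 3 : ℝ) := by
    intro h h0
    have e : (4 / 5 : ℝ) = ((4 / 5 : ℝ) ^ 3) ^ (1 / 3 : ℝ) := by
      rw [← Real.rpow_natCast, ← Real.rpow_mul (by norm_num)]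
      norm_num
    rw [e, ← Real.mul_rpow (by norm_num) h0.le]
    exact Real.rpow_le_rpow (by positivity) (by linarith) (by norm_num)
  have vert : ∀ (k : ℕ) (z : ℍ) (h : ℝ) (h0 : 0 < h), h ≤ 1 → h ≤ 2 ^ k * z.im → ∀ x,
      ‖m z x - m (raise (toClosed z) h0) x‖ ≤ 4 * C * h ^ (1 / 3 : ℝ) := by
    intro k
    induction k with
    | zero =>
      intro z h h0 h1 hz x
      have hz' : h ≤ z.im := by simpa using hz
      have := scale z (raise (toClosed z) h0) h h0 h1 (by
        rw [coe_raise, coe_toClosed, sub_add_cancel_left, norm_neg, norm_mul, Complex.norm_I,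
          Complex.norm_real, Real.norm_of_nonneg h0.le, mul_one]) hz' (by
        rw [im_raise]
        exact le_add_of_nonneg_left z.im_pos.le) x
      have hp : 0 ≤ C * h ^ (1 / 3 : ℝ) := by positivity
      linarith
    | succ k ih =>
      intro z h h0 h1 hz x
      have h2 : 0 < h / 2 := by positivity
      have i1 := ih z (h / 2) h2 (by linarith) (by rw [pow_succ] at hz; linarith) x
      have i2 := scale (raise (toClosed z) h2) (raise (toClosed z) h0) (h / 2) h2 (by linarith)
        (by
          have e : (raise (toClosed z) h2 : ℂ) - raise (toClosed z) h0
              = ((-(h / 2) : ℝ) : ℂ) * Complex.I := by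
            rw [coe_raise, coe_raise]
            push_cast
            ring
          rw [e, norm_mul, Complex.norm_I, Complex.norm_real, norm_neg,
            Real.norm_of_nonneg h2.le, mul_one])
        (by rw [im_raise]; exact le_add_of_nonneg_left z.im_pos.le)
        (by
          rw [im_raise]
          have : 0 < ((toClosed z : ClosedUpperHalfPlane) : ℂ).im := z.im_pos
          linarith) x
      have i3 := mul_le_mul_of_nonneg_left (half h h0) hC0.le
      have i4 := norm_sub_le_norm_sub_add_norm_sub (m z x) (m (raise (toClosed z) h2) x)
        (m (raise (toClosed z) h0) x)
      linarith
  have vert' : ∀ (z : ℍ) (h : ℝ) (h0 : 0 < h), h ≤ 1 → ∀ x,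
      ‖m z x - m (raise (toClosed z) h0) x‖ ≤ 4 * C * h ^ (1 / 3 : ℝ) := by
    intro z h h0 h1 x
    obtain ⟨k, hk⟩ := pow_unbounded_of_one_lt (h / z.im) (one_lt_two (α := ℝ))
    exact vert k z h h0 h1 ((div_le_iff₀ z.im_pos).1 hk.le) x
  refine ⟨9 * C + 2 * Φ, by positivity, fun z₁ z₂ x => ?_⟩
  rcases (norm_nonneg ((z₁ : ℂ) - z₂)).eq_or_lt with hd | hd
  · have : z₁ = z₂ := UpperHalfPlane.ext (sub_eq_zero.1 (norm_le_zero_iff.1 hd.ge))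
    rw [this, sub_self, norm_zero]
    positivity
  set d := ‖(z₁ : ℂ) - z₂‖
  have hdp : 0 ≤ d ^ (1 / 3 : ℝ) := by positivity
  rcases le_or_gt d 1 with hd1 | hd1
  · have i1 := vert' z₁ d hd hd1 x
    have i2 := vert' z₂ d hd hd1 x
    have i3 := scale (raise (toClosed z₁) hd) (raise (toClosed z₂) hd) d hd hd1
      (by rw [coe_raise, coe_raise, add_sub_add_right_eq_sub]; exact le_rfl)
      (by rw [im_raise]; exact le_add_of_nonneg_left z₁.im_pos.le)
      (by rw [im_raise]; exact le_add_of_nonneg_left z₂.im_pos.le) x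
    have i4 := norm_sub_le_norm_sub_add_norm_sub (m z₁ x) (m (raise (toClosed z₁) hd) x) (m z₂ x)
    have i5 := norm_sub_le_norm_sub_add_norm_sub (m (raise (toClosed z₁) hd) x)
      (m (raise (toClosed z₂) hd) x) (m z₂ x)
    rw [norm_sub_rev (m (raise (toClosed z₂) hd) x)] at i5
    have := mul_nonneg hΦ.le hdp
    linarith
  · have i1 : 1 ≤ d ^ (1 / 3 : ℝ) := Real.one_le_rpow hd1.le (by norm_num)
    have i2 := (norm_sub_le (m z₁ x) (m z₂ x)).trans (add_le_add (hmΦ z₁ x) (hmΦ z₂ x))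
    have i3 := mul_nonneg hC0.le hdp
    nlinarith

end QVE

/-! ### Extension to the closed half-plane -/

namespace QVE

/-- Points of the open half-plane that approach a given point of the closed half-plane from
above. -/
noncomputable def approach (w : ClosedUpperHalfPlane) (n : ℕ) : ℍ :=
  raise w (h := 1 / ((n : ℝ) + 1)) (by positivity)

lemma tendsto_coe_approach (w : ClosedUpperHalfPlane) :
    Tendsto (fun n => (approach w n : ℂ)) atTop (𝓝 (w : ℂ)) := by
  have h := (Complex.continuous_ofReal.tendsto 0).comp
    (tendsto_one_div_add_atTop_nhds_zero_nat (𝕜 := ℝ))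
  have h2 := (h.mul_const Complex.I).const_add (w : ℂ)
  simpa [approach, coe_raise, Function.comp_def] using h2

lemma tendsto_toClosed_approach (w : ClosedUpperHalfPlane) :
    Tendsto (fun n => toClosed (approach w n)) atTop (𝓝 w) :=
  tendsto_subtype_rng.2 (tendsto_coe_approach w)

variable {X : Type*} [MeasurableSpace X]

lemma IsHolderExtension.continuous {m : ℍ → X → ℂ} {M : X → ClosedUpperHalfPlane → ℂ}
    (hM : IsHolderExtension m M) (x : X) : Continuous (M x) := by
  obtain ⟨C, hC⟩ := hM.holder
  exact (hC x).continuous (by norm_num)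

lemma IsHolderExtension.eq {m : ℍ → X → ℂ} {M M' : X → ClosedUpperHalfPlane → ℂ}
    (hM : IsHolderExtension m M) (hM' : IsHolderExtension m M') : M = M' := by
  funext x w
  have h1 := ((hM.continuous x).tendsto w).comp (tendsto_toClosed_approach w)
  have h2 := ((hM'.continuous x).tendsto w).comp (tendsto_toClosed_approach w)
  refine tendsto_nhds_unique h1 (h2.congr fun n => ?_)
  simp only [Function.comp_apply, hM.extends_eq, hM'.extends_eq]

/-- A bounded function on the open half-plane that is uniformly `1/3`-Hölder continuous extends to
the closed half-plane. Joint measurability holds because the extension is measurable in `x` and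
continuous in `z`. -/
lemma exists_isHolderExtension {m : ℍ → X → ℂ}
    (hm : ∀ z, IsBoundedMeasurable {w : ℂ | 0 < w.im} (m z)) {Φ C : ℝ} (hC0 : 0 < C)
    (hmΦ : ∀ z x, ‖m z x‖ ≤ Φ)
    (hC : ∀ (z₁ z₂ : ℍ) (x : X), ‖m z₁ x - m z₂ x‖ ≤ C * ‖(z₁ : ℂ) - z₂‖ ^ (1 / 3 : ℝ)) :
    ∃ M : X → ClosedUpperHalfPlane → ℂ, IsHolderExtension m M := by
  have rpow_lim : ∀ {ι : Type} {l : Filter ι} {f g : ι → ℂ} {b c : ℂ}, Tendsto f l (𝓝 b) →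
      Tendsto g l (𝓝 c) → Tendsto (fun i => C * ‖f i - g i‖ ^ (1 / 3 : ℝ)) l
        (𝓝 (C * ‖b - c‖ ^ (1 / 3 : ℝ))) := fun hf hg =>
    ((hf.sub hg).norm.rpow_const (Or.inr (by norm_num))).const_mul C
  have hcauchy : ∀ (x : X) (w : ClosedUpperHalfPlane),
      CauchySeq (fun n => m (approach w n) x) := by
    intro x w
    have h1 := rpow_lim ((tendsto_coe_approach w).comp (tendsto_fst (f := atTop) (g := atTop)))
      ((tendsto_coe_approach w).comp (tendsto_snd (f := atTop) (g := atTop)))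
    rw [sub_self, norm_zero, Real.zero_rpow (by norm_num), mul_zero, prod_atTop_atTop_eq] at h1
    rw [cauchySeq_iff_tendsto_dist_atTop_0]
    refine squeeze_zero (fun _ => dist_nonneg) (fun p => ?_) h1
    rw [dist_eq_norm]
    exact hC _ _ x
  choose M hM using fun x w => cauchySeq_tendsto_of_complete (hcauchy x w)
  have hHol : ∀ x w₁ w₂, ‖M x w₁ - M x w₂‖ ≤ C * ‖(w₁ : ℂ) - w₂‖ ^ (1 / 3 : ℝ) :=
    fun x w₁ w₂ => le_of_tendsto_of_tendsto' ((hM x w₁).sub (hM x w₂)).norm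
      (rpow_lim (tendsto_coe_approach w₁) (tendsto_coe_approach w₂)) fun n => hC _ _ x
  have hHolder : ∀ x, HolderWith C.toNNReal (1 / 3) (M x) := by
    intro x w₁ w₂
    have hd : edist (M x w₁) (M x w₂) = ENNReal.ofReal ‖M x w₁ - M x w₂‖ := by
      rw [edist_dist, dist_eq_norm]
    have hd' : edist w₁ w₂ = ENNReal.ofReal ‖(w₁ : ℂ) - w₂‖ := by
      rw [edist_dist, Subtype.dist_eq, dist_eq_norm]
    rw [hd, hd', ENNReal.ofReal_rpow_of_nonneg (norm_nonneg _) (by positivity)]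
    change _ ≤ ENNReal.ofReal C * _
    rw [← ENNReal.ofReal_mul hC0.le]
    refine ENNReal.ofReal_le_ofReal ((hHol x w₁ w₂).trans (le_of_eq ?_))
    norm_num
  refine ⟨M, ⟨?_, ?_, Φ, ?_⟩, ?_, C.toNNReal, hHolder⟩
  · have hc : ∀ x, Continuous (M x) := fun x => (hHolder x).continuous (by norm_num)
    have hmeas : ∀ w, Measurable (fun x => M x w) := fun w =>
      measurable_of_tendsto_metrizable (fun n => (hm (approach w n)).measurable)
        (tendsto_pi_nhds.2 fun x => hM x w)
    have := measurable_uncurry_of_continuous_of_measurable (u := fun w x => M x w) hc hmeas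
    exact this.comp measurable_swap
  · rintro ⟨x, w⟩
    exact ge_of_tendsto' ((Complex.continuous_im.tendsto _).comp (hM x w))
      fun n => ((hm (approach w n)).mem x).le
  · rintro ⟨x, w⟩
    exact le_of_tendsto' (hM x w).norm fun n => hmΦ _ x
  · intro x z
    refine tendsto_nhds_unique (hM x (toClosed z)) ?_
    rw [tendsto_iff_norm_sub_tendsto_zero]
    have h1 := rpow_lim (tendsto_coe_approach (toClosed z)) (tendsto_const_nhds (x := (z : ℂ)))
    rw [coe_toClosed, sub_self, norm_zero, Real.zero_rpow (by norm_num), mul_zero] at h1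
    exact squeeze_zero (fun _ => norm_nonneg _) (fun n => hC _ _ x) h1

end QVE

theorem mainTheorem2 {X : Type*} [MeasurableSpace X]
    (π : MeasureTheory.Measure X) [MeasureTheory.IsFiniteMeasure π] (hπ : π ≠ 0)
    (a : X → ℝ) (ha : QVE.IsBoundedMeasurable Set.univ a)
    (s : X → X → ℝ) (hs : QVE.IsKernel s)
    (hA : QVE.DiagonalPositivity π s)
    (hB : QVE.UniformPrimitivity π s)
    (hC : QVE.ComponentRegularity π a s) :
    (∃! m : UpperHalfPlane → X → ℂ, QVE.IsSolution π a s m) ∧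
    ∀ m : UpperHalfPlane → X → ℂ, QVE.IsSolution π a s m →
      ∃! M : X → QVE.ClosedUpperHalfPlane → ℂ, QVE.IsHolderExtension m M := by
  refine ⟨QVE.existsUnique_isSolution ha hs, fun m hm => ?_⟩
  obtain ⟨Φ, hΦ, hmΦ⟩ := QVE.exists_norm_solution_le ha hs hA hC hm
  obtain ⟨C, hC0, hHol⟩ := QVE.exists_holder_solution ha hs hA hB hm hΦ hmΦ
  obtain ⟨M, hM⟩ := QVE.exists_isHolderExtension hm.bddMeas hC0 hmΦ hHol
  exact ⟨M, hM, fun M' hM' => hM'.eq hM⟩
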